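/- Let $Q=[-1,1]^2$ and let $\mathbb{P}_n^2$ be the space of real bivariate polynomials of total degree at most $n$. For a positive even integer $n$, let $MP_n=\{(x_m,y_k): 1\le m\le n+1,\ 1\le k\le \tfrac n2+1\}$ be the set of Morrow--Patterson points, where $$x_m=\cos\frac{m\pi}{n+2},\qquad y_k=\begin{cases}\cos\frac{2k\pi}{n+3}, & m \text{ odd},\\[2pt] \cos\frac{(2k-1)\pi}{n+3}, & m\text{ even.}\end{cases}$$ Then, for every positive even $n$, the set $MP_n$ is unisolvent for $\mathbb{P}_n^2$: for all real data on $MP_n$ there is exactly one interpolating polynomial in $\mathbb{P}_n^2$. For $a\in MP_n$ let $\ell_a\in\mathbb{P}_n^2$ be the fundamental Lagrange polynomial, i.e. $\ell_a(a)=1$ and $\ell_a(b)=0$ for $b\in MP_n\setminus\{a\}$; let $\lambda_n(x,y)=\sum_{a\in MP_n}|\ell_a(x,y)|$ be the Lebesgue function and $\Lambda_n^{MP}=\max_{(x,y)\in Q}\lambda_n(x,y)$ the Lebesgue constant. Then: 1. $\Lambda_n^{MP}=\mathcal{O}(n^2)$: there is a constant $C$ such that $\Lambda_n^{MP}\le C\,n^2$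 for all positive even $n$. 2. For every $\delta\in(0,\tfrac{\pi}{2})$ there is a constant $C_\delta$ such that $\lambda_n(x,y)\le C_\delta\, n$ for all positive even $n$ and all $(x,y)\in[\cos(\pi-\delta),\cos\delta]^2$. -/

import Mathlib

namespace MorrowPatterson

/-- The square `Q = [-1,1]²`. -/
def square : Set (ℝ × ℝ) := Set.Icc (-1) 1 ×ˢ Set.Icc (-1) 1

/-- The space of real bivariate polynomials of total degree at most `n`. -/
noncomputable def polySpace (n : ℕ) : Submodule ℝ (MvPolynomial (Fin 2) ℝ) :=
  MvPolynomial.restrictTotalDegree (Fin 2) ℝ n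

/-- The value `p(x, y)` of a bivariate polynomial at the point `z = (x, y)`. -/
noncomputable def evalAt (p : MvPolynomial (Fin 2) ℝ) (z : ℝ × ℝ) : ℝ :=
  MvPolynomial.eval ![z.1, z.2] p

/-- `p` is a polynomial of total degree at most `n` that interpolates `f` on the node set `S`. -/
def Interpolates (S : Finset (ℝ × ℝ)) (n : ℕ) (f : ℝ × ℝ → ℝ)
    (p : MvPolynomial (Fin 2) ℝ) : Prop :=
  p ∈ polySpace n ∧ ∀ a ∈ S, evalAt p a = f a

/-- The node set `S` is unisolvent for the polynomials of total degree at most `n`: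
every data on `S` has exactly one interpolant. -/
def IsUnisolvent (S : Finset (ℝ × ℝ)) (n : ℕ) : Prop :=
  ∀ f : ℝ × ℝ → ℝ, ∃! p : MvPolynomial (Fin 2) ℝ, Interpolates S n f p

open Classical in
/-- The interpolation polynomial of `f` at the nodes `S` (meaningful when `S` is unisolvent). -/
noncomputable def interpolant (S : Finset (ℝ × ℝ)) (n : ℕ) (f : ℝ × ℝ → ℝ) :
    MvPolynomial (Fin 2) ℝ :=
  if h : ∃ p, Interpolates S n f p then h.choose else 0

open Classical in
/-- The fundamental Lagrange polynomial of the node `a ∈ S`: it interpolates the data that are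
`1` at `a` and `0` at the other nodes. -/
noncomputable def lagrangePoly (S : Finset (ℝ × ℝ)) (n : ℕ) (a : ℝ × ℝ) :
    MvPolynomial (Fin 2) ℝ :=
  interpolant S n (fun b => if b = a then 1 else 0)

/-- The Lebesgue function of interpolation at `S`: the sum of the absolute values of the
fundamental Lagrange polynomials. -/
noncomputable def lebesgueFunction (S : Finset (ℝ × ℝ)) (n : ℕ) (z : ℝ × ℝ) : ℝ :=
  ∑ a ∈ S, |evalAt (lagrangePoly S n a) z|

/-- The Lebesgue constant of interpolation at `S` on the square: the maximum of the Lebesgue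
function over the square (see `isGreatest_lebesgueConstant`). -/
noncomputable def lebesgueConstant (S : Finset (ℝ × ℝ)) (n : ℕ) : ℝ :=
  sSup (lebesgueFunction S n '' square)

theorem continuous_lebesgueFunction (S : Finset (ℝ × ℝ)) (n : ℕ) :
    Continuous (lebesgueFunction S n) := by
  unfold lebesgueFunction evalAt
  refine continuous_finsetSum _ fun a _ => Continuous.abs ?_
  refine (MvPolynomial.continuous_eval (lagrangePoly S n a)).comp ?_
  refine continuous_pi fun i => ?_
  fin_cases i
  · exact continuous_fst
  · exact continuous_snd

/-- The supremum in the definition of the Lebesgue constant is attained. -/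
theorem isGreatest_lebesgueConstant (S : Finset (ℝ × ℝ)) (n : ℕ) :
    IsGreatest (lebesgueFunction S n '' square) (lebesgueConstant S n) := by
  have hQ : IsCompact square := isCompact_Icc.prod isCompact_Icc
  have hne : square.Nonempty := ⟨(0, 0), by simp [square]⟩
  exact (hQ.image (continuous_lebesgueFunction S n)).isGreatest_sSup (hne.image _)

/-- The Morrow-Patterson node `(x_m, y_k)` of degree `n`. -/
noncomputable def node (n m k : ℕ) : ℝ × ℝ :=
  (Real.cos ((m : ℝ) * Real.pi / ((n : ℝ) + 2)),
    if Odd m then Real.cos (2 * (k : ℝ) * Real.pi / ((n : ℝ) + 3))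
    else Real.cos ((2 * (k : ℝ) - 1) * Real.pi / ((n : ℝ) + 3)))

open Classical in
/-- The set of Morrow-Patterson points of even degree `n`:
`(x_m, y_k)` with `1 ≤ m ≤ n + 1` and `1 ≤ k ≤ n / 2 + 1`. -/
noncomputable def points (n : ℕ) : Finset (ℝ × ℝ) :=
  (Finset.Icc 1 (n + 1) ×ˢ Finset.Icc 1 (n / 2 + 1)).image (fun i => node n i.1 i.2)

end MorrowPatterson

namespace MorrowPatterson

open Finset Real

/-! The Morrow-Patterson points are the interior points `(m, j)` of a Chebyshev product grid with `m
+ j` odd. Restricting to them adds to the grid quadrature a copy twisted by `(-1) ^ (m + j)`, and on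
the grid this twist reflects the degrees of `U_i U_j`. The reflected terms are orthogonal to
everything of degree at most `n`, so the products `U_i U_j`, `i + j ≤ n`, are orthonormal for the
weighted nodes. There are as many nodes as products, so the evaluation matrix is invertible: the
points are unisolvent, and each Lagrange polynomial is a weight times the reproducing kernel `K`
(`weight_mul_kernel₂`).

The Lebesgue function is therefore at most twice the discrete `L¹` norm of `K(z, ·)`. On the
interior square the `U_i` are bounded, and Cauchy-Schwarz with Parseval gives `O(n)`.

Near a corner the `L²` norm can have order `n³`, so Cauchy-Schwarz is applied with a weight `g`
(`concentration`). With `s`, `r` the signs of `x`, `y` and `σ = s r`, a Christoffel-Darboux formula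
for `((x' - x) - σ (y' - y)) K` has coefficients in which the terms of order `n²` cancel
(`boundary_coeff_sq_le`). This gives `∑ g K² = O(n³)`, while a sum of Lorentzian profiles gives `∑
1/g = O(n)` (`gridQuad_inv_concentration_le`). The product is `O(n⁴)`, hence the `L¹` norm is
`O(n²)`. -/

/-- The value at `x` of the Chebyshev polynomial of the second kind of index `i`. -/
noncomputable def chebU (i : ℤ) (x : ℝ) : ℝ := (Polynomial.Chebyshev.U ℝ i).eval x

/-! ### Pointwise bounds for Chebyshev polynomials of the second kind -/

theorem chebU_zero (x : ℝ) : chebU 0 x = 1 := by simp [chebU]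

theorem chebU_neg_one (x : ℝ) : chebU (-1) x = 0 := by simp [chebU]

theorem chebU_add_one (i : ℤ) (x : ℝ) :
    chebU (i + 1) x = 2 * x * chebU i x - chebU (i - 1) x := by
  simp [chebU, Polynomial.Chebyshev.U_add_one]

theorem chebU_cos (i : ℤ) (θ : ℝ) : chebU i (cos θ) * sin θ = sin ((i + 1) * θ) :=
  Polynomial.Chebyshev.U_real_cos θ i

/-- The three-term recurrence preserves this quadratic form; all pointwise bounds below come from
it. -/
theorem chebU_sq_sub_add_sq (i : ℕ) (x : ℝ) :
    chebU i x ^ 2 - 2 * x * chebU i x * chebU (i - 1) x + chebU (i - 1) x ^ 2 = 1 := by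
  induction i with
  | zero => simp [chebU_zero, chebU_neg_one]
  | succ i ih =>
    rw [← ih]
    push_cast
    rw [chebU_add_one, add_sub_cancel_right]
    ring

theorem one_sub_sq_mul_chebU_sq_le_one (i : ℕ) (x : ℝ) : (1 - x ^ 2) * chebU i x ^ 2 ≤ 1 := by
  nlinarith [chebU_sq_sub_add_sq i x, sq_nonneg (chebU (i - 1) x - x * chebU i x)]

/-- The combinations `U_i ± s U_{i-1}` diagonalise the invariant form. When `s` is the sign of `x`,
the difference carries the coefficient `1 + s x ≥ 1`, so it stays bounded even at `x = s`, where
`U_i` itself has size `i + 1`. -/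
theorem chebU_sub_sq_le_two (i : ℕ) {s x : ℝ} (hs : s ^ 2 = 1) (hsx : 0 ≤ s * x)
    (hx : s * x ≤ 1) : (chebU i x - s * chebU (i - 1) x) ^ 2 ≤ 2 := by
  have key : (chebU i x - s * chebU (i - 1) x) ^ 2 * (1 + s * x) +
      (chebU i x + s * chebU (i - 1) x) ^ 2 * (1 - s * x) = 2 := by
    linear_combination 2 * chebU_sq_sub_add_sq i x +
      (2 * chebU (i - 1) x ^ 2 - 4 * x * chebU i x * chebU (i - 1) x) * hs
  nlinarith [mul_nonneg (sq_nonneg (chebU i x + s * chebU (i - 1) x)) (sub_nonneg.2 hx),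
    mul_nonneg (sq_nonneg (chebU i x - s * chebU (i - 1) x)) hsx]

theorem abs_chebU_le (i : ℕ) {s x : ℝ} (hs : s ^ 2 = 1) (hsx : 0 ≤ s * x)
    (hx : s * x ≤ 1) : |chebU i x| ≤ 2 * (i + 1) := by
  have hs1 : |s| = 1 := by rw [← sq_abs] at hs; nlinarith [abs_nonneg s]
  induction i with
  | zero => norm_num [chebU_zero]
  | succ i ih =>
    have h := chebU_sub_sq_le_two (i + 1) hs hsx hx
    push_cast at h ⊢
    rw [add_sub_cancel_right] at h
    have h1 : |chebU (i + 1) x - s * chebU i x| ≤ 2 := abs_le_of_sq_le_sq (by linarith) (by norm_num)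
    have h2 : |chebU (i + 1) x| ≤ |chebU (i + 1) x - s * chebU i x| + |s * chebU i x| := by
      simpa using abs_add_le (chebU (i + 1) x - s * chebU i x) (s * chebU i x)
    rw [abs_mul, hs1] at h2
    linarith

/-! ### Univariate kernel and Gaussian quadrature -/

/-- The one-dimensional reproducing kernel `∑_{i ≤ M} U_i(x) U_i(t)`. -/
noncomputable def kernel₁ (M : ℕ) (x t : ℝ) : ℝ := ∑ i ∈ range (M + 1), chebU i x * chebU i t

/-- The Christoffel-Darboux formula. -/
theorem christoffel_darboux (M : ℕ) (x t : ℝ) :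
    2 * (t - x) * kernel₁ M x t =
      chebU (M + 1) t * chebU M x - chebU M t * chebU (M + 1) x := by
  unfold kernel₁
  induction M with
  | zero =>
    have h (y : ℝ) : chebU (0 + 1) y = 2 * y := by rw [chebU_add_one]; simp [chebU_zero, chebU_neg_one]
    simp only [sum_range_succ, sum_range_zero, Nat.cast_zero, h, chebU_zero]
    ring
  | succ M ih =>
    rw [sum_range_succ, mul_add, ih]
    push_cast
    rw [chebU_add_one (M + 1) t, chebU_add_one (M + 1) x, add_sub_cancel_right]
    ring

/-- The Gaussian quadrature with `N - 1` nodes for the Chebyshev weight of the second kind. -/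
noncomputable def sineQuad (N : ℕ) (f : ℝ → ℝ) : ℝ :=
  2 / N * ∑ m ∈ range N, sin (m * π / N) ^ 2 * f (cos (m * π / N))

theorem sineQuad_add (N : ℕ) (f g : ℝ → ℝ) :
    sineQuad N (fun t => f t + g t) = sineQuad N f + sineQuad N g := by
  simp only [sineQuad, mul_add, sum_add_distrib]

theorem sineQuad_const_mul (N : ℕ) (c : ℝ) (f : ℝ → ℝ) :
    sineQuad N (fun t => c * f t) = c * sineQuad N f := by
  simp only [sineQuad, mul_sum]
  exact sum_congr rfl fun _ _ => by ring

theorem sineQuad_sum {ι : Type*} (N : ℕ) (s : Finset ι) (f : ι → ℝ → ℝ) :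
    sineQuad N (fun t => ∑ i ∈ s, f i t) = ∑ i ∈ s, sineQuad N (f i) := by
  simp only [sineQuad, mul_sum]
  exact sum_comm

theorem sineQuad_mono (N : ℕ) {f g : ℝ → ℝ} (h : ∀ t, f t ≤ g t) : sineQuad N f ≤ sineQuad N g := by
  unfold sineQuad
  gcongr
  exact h _

/-- Multiplication by `2 sin (k π / (2 N))` telescopes the sum, and the bounds on `k` keep this sine
nonzero. The value depends only on the parity of `k`. -/
theorem sum_cos_mul_pi_div {N : ℕ} {k : ℤ} (hk : k ≠ 0) (hkN : |k| < 2 * N) :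
    ∑ m ∈ range N, cos (k * (m * π / N)) = (1 - cos (k * π)) / 2 := by
  have hN : (N : ℝ) ≠ 0 := by
    rintro h
    have : N = 0 := by exact_mod_cast h
    subst this
    have := abs_nonneg k
    simp at hkN; omega
  set α : ℝ := k * π / (2 * N) with hα
  have hsin : sin α ≠ 0 := by
    rw [Ne, sin_eq_zero_iff]
    rintro ⟨l, hl⟩
    rw [hα] at hl
    field_simp at hl
    have hl' : (l : ℝ) * 2 * N = k := by linarith
    have hl2 : l * 2 * N = k := by exact_mod_cast hl'
    rcases eq_or_ne l 0 with rfl | h0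
    · simp at hl2; omega
    · have h1 : 1 ≤ |l| := Int.one_le_abs h0
      rw [← hl2, abs_mul, abs_mul] at hkN
      simp at hkN
      nlinarith
  have htel : ∀ M : ℕ, 2 * sin α * ∑ m ∈ range M, cos (k * (m * π / N)) =
      sin ((2 * M - 1) * α) + sin α := by
    intro M
    induction M with
    | zero => simp
    | succ M ih =>
      rw [sum_range_succ, mul_add, ih]
      have e : (k : ℝ) * (M * π / N) = 2 * M * α := by rw [hα]; field_simp
      rw [e]
      have e1 : (2 * ((M + 1 : ℕ) : ℝ) - 1) * α = 2 * M * α + α := by push_cast; ring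
      have e2 : (2 * (M : ℝ) - 1) * α = 2 * M * α - α := by ring
      rw [e1, e2, sin_add, sin_sub]
      ring
  have h := htel N
  have e : (2 * (N : ℝ) - 1) * α = k * π - α := by rw [hα]; field_simp
  rw [e, sin_sub, sin_int_mul_pi] at h
  have : 2 * sin α * (∑ m ∈ range N, cos (k * (m * π / N)) - (1 - cos (k * π)) / 2) = 0 := by
    linear_combination h
  simpa [hsin, sub_eq_zero] using this

/-- Discrete orthogonality of the Chebyshev polynomials of the second kind. -/
theorem sineQuad_chebU_mul_chebU {N i j : ℕ} (h : i + j + 2 < 2 * N) :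
    sineQuad N (fun t => chebU i t * chebU j t) = if i = j then 1 else 0 := by
  have hN : (N : ℝ) ≠ 0 := by norm_cast; omega
  have hterm (θ : ℝ) : sin θ ^ 2 * (chebU i (cos θ) * chebU j (cos θ)) =
      (cos (((i - j : ℤ) : ℝ) * θ) - cos (((i + j + 2 : ℤ) : ℝ) * θ)) / 2 := by
    have e : sin θ ^ 2 * (chebU i (cos θ) * chebU j (cos θ)) =
      (chebU i (cos θ) * sin θ) * (chebU j (cos θ) * sin θ) := by ring
    rw [e, chebU_cos, chebU_cos]
    push_cast
    have e1 : ((i : ℝ) - j) * θ = (i + 1) * θ - (j + 1) * θ := by ring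
    have e2 : ((i : ℝ) + j + 2) * θ = (i + 1) * θ + (j + 1) * θ := by ring
    rw [e1, e2, cos_add, cos_sub]
    ring
  simp only [sineQuad, hterm]
  rw [← sum_div, sum_sub_distrib,
    sum_cos_mul_pi_div (k := (i + j + 2 : ℤ)) (by omega) (by rw [abs_lt]; omega)]
  split_ifs with hij
  · subst hij
    have : cos (((i + i + 2 : ℤ) : ℝ) * π) = 1 := by
      rw [show ((i + i + 2 : ℤ) : ℝ) * π = ((i + 1 : ℤ) : ℝ) * (2 * π) by push_cast; ring]
      exact cos_int_mul_two_pi _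
    rw [this]
    simp only [sub_self, Int.cast_zero, zero_mul, cos_zero, sum_const, card_range, nsmul_eq_mul]
    field_simp
    ring
  · rw [sum_cos_mul_pi_div (k := (i - j : ℤ)) (by omega) (by rw [abs_lt]; omega)]
    -- The frequencies `i - j` and `i + j + 2` have the same parity, so the two cosine sums cancel.
    have : cos (((i + j + 2 : ℤ) : ℝ) * π) = cos (((i - j : ℤ) : ℝ) * π) := by
      rw [show ((i + j + 2 : ℤ) : ℝ) * π = ((i - j : ℤ) : ℝ) * π + ((j + 1 : ℤ) : ℝ) * (2 * π) by
        push_cast; ring]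
      exact cos_add_int_mul_two_pi _ _
    rw [this]
    simp

theorem sineQuad_chebU_mul_sum {N p M : ℕ} (h : p + M + 1 < 2 * N) (f : ℕ → ℝ) :
    sineQuad N (fun t => chebU p t * ∑ i ∈ range M, f i * chebU i t) =
      if p < M then f p else 0 := by
  have e : (fun t => chebU p t * ∑ i ∈ range M, f i * chebU i t) =
      fun t => ∑ i ∈ range M, f i * (chebU p t * chebU i t) := by
    funext t
    rw [mul_sum]
    exact sum_congr rfl fun _ _ => by ring
  rw [e, sineQuad_sum]
  have : ∀ i ∈ range M, sineQuad N (fun t => f i * (chebU p t * chebU i t)) =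
      if p = i then f i else 0 := by
    intro i hi
    rw [mem_range] at hi
    rw [sineQuad_const_mul, sineQuad_chebU_mul_chebU (by omega)]
    simp
  rw [sum_congr rfl this, sum_ite_eq]
  simp

/-- Discrete Parseval identity. -/
theorem sineQuad_sum_sq {N M : ℕ} (h : M < N) (f : ℕ → ℝ) :
    sineQuad N (fun t => (∑ i ∈ range M, f i * chebU i t) ^ 2) = ∑ i ∈ range M, f i ^ 2 := by
  have e : (fun t => (∑ i ∈ range M, f i * chebU i t) ^ 2) = fun t => ∑ p ∈ range M,
      f p * (chebU p t * ∑ i ∈ range M, f i * chebU i t) := by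
    funext t
    rw [sq]
    nth_rewrite 1 [sum_mul]
    exact sum_congr rfl fun _ _ => by ring
  rw [e, sineQuad_sum]
  refine sum_congr rfl fun p hp => ?_
  rw [mem_range] at hp
  rw [sineQuad_const_mul, sineQuad_chebU_mul_sum (by omega), if_pos hp, sq]

/-- The case `i = N - 1` lies just outside the range of exactness, but there every weighted node
value vanishes. -/
theorem sineQuad_chebU_sq_le_one {N i : ℕ} (h : i < N) :
    sineQuad N (fun t => chebU i t ^ 2) ≤ 1 := by
  rcases Nat.lt_or_ge (i + 1) N with h1 | h1
  · simp only [sq]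
    rw [sineQuad_chebU_mul_chebU (by omega), if_pos rfl]
  · obtain rfl : N = i + 1 := by omega
    have : ∀ m : ℕ, sin (m * π / (i + 1 : ℕ)) ^ 2 * chebU i (cos (m * π / (i + 1 : ℕ))) ^ 2 = 0 := by
      intro m
      rw [← mul_pow, mul_comm, chebU_cos]
      push_cast
      rw [mul_div_cancel₀ _ (by positivity), sin_nat_mul_pi]
      simp
    simp only [sineQuad, this]
    simp

/-- Write `1 - s t = (1 - s x) - s (t - x)` and apply Christoffel-Darboux to `(t - x) K`. Paired
with `K(x, ·)`, the `U_{M+1}` term vanishes and the `U_M` term is reproduced. -/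
theorem sineQuad_one_sub_mul_kernel₁_sq {N M : ℕ} (h : M + 1 < N) (s x : ℝ) :
    sineQuad N (fun t => (1 - s * t) * kernel₁ M x t ^ 2) =
      (1 - s * x) * ∑ i ∈ range (M + 1), chebU i x ^ 2 + s / 2 * (chebU M x * chebU (M + 1) x) := by
  have e : (fun t => (1 - s * t) * kernel₁ M x t ^ 2) = fun t =>
      (1 - s * x) * kernel₁ M x t ^ 2 + (-(s / 2) * chebU M x * (chebU (M + 1 : ℕ) t * kernel₁ M x t)
        + s / 2 * chebU (M + 1) x * (chebU M t * kernel₁ M x t)) := by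
    funext t
    push_cast
    linear_combination (-s / 2 * kernel₁ M x t) * christoffel_darboux M x t
  rw [e, sineQuad_add, sineQuad_add, sineQuad_const_mul, sineQuad_const_mul, sineQuad_const_mul]
  simp only [kernel₁]
  rw [sineQuad_sum_sq (by omega), sineQuad_chebU_mul_sum (by omega),
    sineQuad_chebU_mul_sum (by omega)]
  simp
  ring

/-! ### Bivariate kernel on the product grid -/

/-- The reproducing kernel `∑_{i + j ≤ n} U_i(x) U_j(y) U_i(x') U_j(y')`. -/
noncomputable def kernel₂ (n : ℕ) (x y x' y' : ℝ) : ℝ :=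
  ∑ j ∈ range (n + 1), chebU j y * kernel₁ (n - j) x x' * chebU j y'

theorem kernel₂_swap (n : ℕ) (x y x' y' : ℝ) : kernel₂ n x y x' y' = kernel₂ n y x y' x' := by
  simp only [kernel₂, kernel₁, mul_sum, sum_mul]
  rw [sum_comm' (t' := range (n + 1)) (s' := fun i => range (n - i + 1))]
  · exact sum_congr rfl fun _ _ => sum_congr rfl fun _ _ => by ring
  · intro i j
    simp only [mem_range]
    omega

/-- The product of the quadratures with `n + 1` and `n + 2` nodes. -/
noncomputable def gridQuad (n : ℕ) (f : ℝ → ℝ → ℝ) : ℝ :=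
  sineQuad (n + 2) fun x => sineQuad (n + 3) fun y => f x y

theorem gridQuad_add (n : ℕ) (f g : ℝ → ℝ → ℝ) :
    gridQuad n (fun x y => f x y + g x y) = gridQuad n f + gridQuad n g := by
  simp only [gridQuad, sineQuad_add]

theorem gridQuad_const_mul (n : ℕ) (c : ℝ) (f : ℝ → ℝ → ℝ) :
    gridQuad n (fun x y => c * f x y) = c * gridQuad n f := by
  simp only [gridQuad, sineQuad_const_mul]

theorem gridQuad_mono (n : ℕ) {f g : ℝ → ℝ → ℝ} (h : ∀ x y, f x y ≤ g x y) :
    gridQuad n f ≤ gridQuad n g :=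
  sineQuad_mono _ fun _ => sineQuad_mono _ fun _ => h _ _

theorem gridQuad_eq_sum (n : ℕ) (f : ℝ → ℝ → ℝ) :
    gridQuad n f = ∑ a ∈ range (n + 2) ×ˢ range (n + 3),
      4 / ((n + 2) * (n + 3)) * (sin (a.1 * π / (n + 2)) ^ 2 * sin (a.2 * π / (n + 3)) ^ 2) *
        f (cos (a.1 * π / (n + 2))) (cos (a.2 * π / (n + 3))) := by
  simp only [gridQuad, sineQuad, mul_sum, sum_product]
  refine sum_congr rfl fun _ _ => sum_congr rfl fun _ _ => ?_
  push_cast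
  field_simp
  ring

/-- Parseval in `y` removes the cross terms, and each `U_{L-j}` has norm at most one in `x`. The top
level `L = n + 1` is needed for the Christoffel-Darboux formula. -/
theorem gridQuad_level_sq_le {n L : ℕ} (hL : L ≤ n + 1) (A : ℕ → ℝ) :
    gridQuad n (fun x y => (∑ j ∈ range (L + 1), A j * chebU (L - j) x * chebU j y) ^ 2) ≤
      ∑ j ∈ range (L + 1), A j ^ 2 := by
  unfold gridQuad
  simp only [sineQuad_sum_sq (show L + 1 < n + 3 by omega), mul_pow]
  rw [sineQuad_sum]
  refine sum_le_sum fun j hj => ?_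
  rw [mem_range] at hj
  rw [sineQuad_const_mul, show (L : ℤ) - j = ((L - j : ℕ) : ℤ) by omega]
  exact mul_le_of_le_one_right (sq_nonneg _) (sineQuad_chebU_sq_le_one (by omega))

theorem two_mul_fst_sub_mul_kernel₂ (n : ℕ) (x y x' y' : ℝ) :
    2 * (x' - x) * kernel₂ n x y x' y' =
      ∑ j ∈ range (n + 1), chebU j y * chebU j y' *
        (chebU (n + 1 - j) x' * chebU (n - j) x - chebU (n - j) x' * chebU (n + 1 - j) x) := by
  rw [kernel₂, mul_sum]
  refine sum_congr rfl fun j hj => ?_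
  rw [mem_range] at hj
  have h := christoffel_darboux (n - j) x x'
  rw [show ((n - j : ℕ) : ℤ) = n - j by omega,
    show (n : ℤ) - j + 1 = n + 1 - j by ring] at h
  rw [← h]
  ring

/-- A bivariate Christoffel-Darboux formula. -/
theorem two_mul_sub_mul_kernel₂ (n : ℕ) (σ x y x' y' : ℝ) :
    2 * ((x' - x) - σ * (y' - y)) * kernel₂ n x y x' y' =
      (∑ j ∈ range (n + 1 + 1),
        (chebU (n - j) x * chebU j y - σ * (chebU (n + 1 - j) x * chebU (j - 1) y)) *
          chebU ((n + 1 : ℕ) - j) x' * chebU j y') -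
      ∑ j ∈ range (n + 1),
        (chebU (n + 1 - j) x * chebU j y - σ * (chebU (n - j) x * chebU (j + 1) y)) *
          chebU (n - j) x' * chebU j y' := by
  have h1 := two_mul_fst_sub_mul_kernel₂ n x y x' y'
  have h2 : 2 * (y' - y) * kernel₂ n x y x' y' =
      ∑ j ∈ range (n + 1), chebU (n - j) x * chebU (n - j) x' *
        (chebU (j + 1) y' * chebU j y - chebU j y' * chebU (j + 1) y) := by
    rw [kernel₂_swap, two_mul_fst_sub_mul_kernel₂,
      ← sum_flip (n := n) (fun j : ℕ => chebU j x * chebU j x' *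
        (chebU (n + 1 - j) y' * chebU (n - j) y - chebU (n - j) y' * chebU (n + 1 - j) y))]
    refine sum_congr rfl fun j hj => ?_
    rw [mem_range] at hj
    simp only [show ((n - j : ℕ) : ℤ) = n - j by omega, show (n : ℤ) + 1 - (n - j) = j + 1 by ring,
      show (n : ℤ) - (n - j) = j by ring]
  -- The extra term `j = n + 1` contains `U_{-1}(x) = 0`; in `h4` the term `j = 0` contains
  -- `U_{-1}(y) = 0`, so the index can be shifted.
  have h3 : ∑ j ∈ range (n + 1 + 1), chebU (n - j) x * chebU j y * chebU (n + 1 - j) x' * chebU j y'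
      = ∑ j ∈ range (n + 1), chebU (n - j) x * chebU j y * chebU (n + 1 - j) x' * chebU j y' := by
    rw [sum_range_succ]
    simp [chebU_neg_one]
  have h4 : ∑ j ∈ range (n + 1 + 1),
        chebU (n + 1 - j) x * chebU (j - 1) y * chebU (n + 1 - j) x' * chebU j y'
      = ∑ j ∈ range (n + 1), chebU (n - j) x * chebU j y * chebU (n - j) x' * chebU (j + 1) y' := by
    rw [sum_range_succ']
    simp [chebU_neg_one]
  have e : 2 * ((x' - x) - σ * (y' - y)) * kernel₂ n x y x' y' =
    2 * (x' - x) * kernel₂ n x y x' y' - σ * (2 * (y' - y) * kernel₂ n x y x' y') := by ring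
  rw [e, h1, h2]
  have e2 : (∑ j ∈ range (n + 1 + 1),
        (chebU (n - j) x * chebU j y - σ * (chebU (n + 1 - j) x * chebU (j - 1) y)) *
          chebU ((n + 1 : ℕ) - j) x' * chebU j y') =
      ∑ j ∈ range (n + 1 + 1), chebU (n - j) x * chebU j y * chebU (n + 1 - j) x' * chebU j y' -
      σ * ∑ j ∈ range (n + 1 + 1),
        chebU (n + 1 - j) x * chebU (j - 1) y * chebU (n + 1 - j) x' * chebU j y' := by
    rw [mul_sum, ← sum_sub_distrib]
    refine sum_congr rfl fun j _ => ?_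
    push_cast
    ring
  rw [e2, h3, h4]
  simp only [mul_sum, ← sum_sub_distrib]
  exact sum_congr rfl fun j _ => by ring

/-! ### Weighted `L²` bounds for the kernel -/

theorem abs_chebU_le_of_le {n : ℕ} {i : ℤ} (hi : -1 ≤ i) (hin : i ≤ n + 1) {s x : ℝ}
    (hs : s ^ 2 = 1) (hsx : 0 ≤ s * x) (hx : s * x ≤ 1) : |chebU i x| ≤ 2 * (n + 2) := by
  rcases hi.eq_or_lt with rfl | hi
  · rw [chebU_neg_one, abs_zero]
    positivity
  · lift i to ℕ using by omega
    have h : (i : ℝ) ≤ n + 1 := by exact_mod_cast hin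
    linarith [abs_chebU_le i hs hsx hx]

theorem sq_chebU_le_of_le {n : ℕ} {i : ℤ} (hi : -1 ≤ i) (hin : i ≤ n + 1) {s x : ℝ}
    (hs : s ^ 2 = 1) (hsx : 0 ≤ s * x) (hx : s * x ≤ 1) : chebU i x ^ 2 ≤ 4 * (n + 2) ^ 2 := by
  rw [← sq_abs]
  calc |chebU i x| ^ 2 ≤ (2 * (n + 2)) ^ 2 :=
        pow_le_pow_left₀ (abs_nonneg _) (abs_chebU_le_of_le hi hin hs hsx hx) 2
    _ = 4 * (n + 2) ^ 2 := by ring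

section Bounds

variable {s r x y : ℝ} (hs : s ^ 2 = 1) (hsx : 0 ≤ s * x) (hx : s * x ≤ 1)
  (hr : r ^ 2 = 1) (hry : 0 ≤ r * y) (hy : r * y ≤ 1)

include hs hsx hx hr hry hy

/-- Substituting `U_p = c + s U_{p-1}` and `U_q = d + r U_{q-1}` cancels the products `U_{p-1}
U_{q-1}`, which may have size `n²`. What remains is a sum of two products of an `O(n)` factor and a
bounded one. -/
theorem boundary_coeff_sq_le {n p q : ℕ} (hp : p ≤ n + 1) (hq : q ≤ n + 1) :
    (chebU (p - 1) x * chebU q y - s * r * (chebU p x * chebU (q - 1) y)) ^ 2 ≤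
      32 * (n + 2) ^ 2 := by
  have hA := sq_chebU_le_of_le (n := n) (i := p - 1) (by omega) (by omega) hs hsx hx
  have hB := sq_chebU_le_of_le (n := n) (i := q - 1) (by omega) (by omega) hr hry hy
  have hC := chebU_sub_sq_le_two p hs hsx hx
  have hD := chebU_sub_sq_le_two q hr hry hy
  set a := chebU (p - 1) x
  set b := chebU (q - 1) y
  set c := chebU p x - s * a with hc
  set d := chebU q y - r * b with hd
  have e : a * chebU q y - s * r * (chebU p x * b) = a * d - s * r * (b * c) := by
    linear_combination (-r * a * b) * hs - a * hd + (s * r * b) * hc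
  have h1 : (a * d) ^ 2 ≤ 8 * (n + 2) ^ 2 := by
    rw [mul_pow]
    nlinarith [mul_le_mul hA hD (sq_nonneg d) (by positivity)]
  have h2 : (s * r * (b * c)) ^ 2 ≤ 8 * (n + 2) ^ 2 := by
    rw [mul_pow, mul_pow, mul_pow, hs, hr]
    nlinarith [mul_le_mul hB hC (sq_nonneg c) (by positivity)]
  rw [e]
  nlinarith [sq_nonneg (a * d + s * r * (b * c))]

theorem gridQuad_sub_sq_mul_kernel₂_sq_le (n : ℕ) :
    gridQuad n (fun x' y' => ((x' - x) - s * r * (y' - y)) ^ 2 * kernel₂ n x y x' y' ^ 2) ≤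
      32 * (n + 2) ^ 3 := by
  set A : ℕ → ℝ := fun j =>
    chebU (n - j) x * chebU j y - s * r * (chebU (n + 1 - j) x * chebU (j - 1) y)
  set B : ℕ → ℝ := fun j =>
    chebU (n + 1 - j) x * chebU j y - s * r * (chebU (n - j) x * chebU (j + 1) y)
  have hA : ∑ j ∈ range (n + 1 + 1), A j ^ 2 ≤ (n + 2) * (32 * (n + 2) ^ 2) := by
    refine (sum_le_card_nsmul _ _ (32 * ((n : ℝ) + 2) ^ 2) fun j hj => ?_).trans_eq ?_
    · rw [mem_range] at hj
      have h := boundary_coeff_sq_le hs hsx hx hr hry hy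
        (n := n) (p := n + 1 - j) (q := j) (by omega) (by omega)
      rw [show ((n + 1 - j : ℕ) : ℤ) = n + 1 - j by omega,
        show (n : ℤ) + 1 - j - 1 = n - j by ring] at h
      exact h
    · rw [card_range, nsmul_eq_mul]
      push_cast
      ring
  have hB : ∑ j ∈ range (n + 1), B j ^ 2 ≤ (n + 1) * (32 * (n + 2) ^ 2) := by
    refine (sum_le_card_nsmul _ _ (32 * ((n : ℝ) + 2) ^ 2) fun j hj => ?_).trans_eq ?_
    · rw [mem_range] at hj
      have h := boundary_coeff_sq_le hs hsx hx hr hry hy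
        (n := n) (p := n + 1 - j) (q := j + 1) (by omega) (by omega)
      rw [show ((n + 1 - j : ℕ) : ℤ) = n + 1 - j by omega,
        show (n : ℤ) + 1 - j - 1 = n - j by ring, Nat.cast_succ, add_sub_cancel_right] at h
      -- Up to the sign `-s r`, `B j` is the boundary coefficient with `p = n + 1 - j` and `q = j +
      -- 1`.
      refine le_trans (le_of_eq ?_) h
      have hsr : (s * r) ^ 2 = 1 := by rw [mul_pow, hs, hr, one_mul]
      simp only [B]
      linear_combination ((chebU (n - j) x * chebU (j + 1) y) ^ 2 -
        (chebU (n + 1 - j) x * chebU j y) ^ 2) * hsr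
    · simp
  have hle : ∀ x' y', ((x' - x) - s * r * (y' - y)) ^ 2 * kernel₂ n x y x' y' ^ 2 ≤
      1 / 2 * ((∑ j ∈ range (n + 1 + 1), A j * chebU ((n + 1 : ℕ) - j) x' * chebU j y') ^ 2 +
        (∑ j ∈ range (n + 1), B j * chebU (n - j) x' * chebU j y') ^ 2) := by
    intro x' y'
    have h := two_mul_sub_mul_kernel₂ n (s * r) x y x' y'
    set P := ∑ j ∈ range (n + 1 + 1), A j * chebU ((n + 1 : ℕ) - j) x' * chebU j y'
    set R := ∑ j ∈ range (n + 1), B j * chebU (n - j) x' * chebU j y'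
    rw [← mul_pow]
    have h' : ((x' - x) - s * r * (y' - y)) * kernel₂ n x y x' y' = (P - R) / 2 := by
      linear_combination h / 2
    rw [h']
    nlinarith [sq_nonneg (P + R)]
  refine (gridQuad_mono n hle).trans ?_
  rw [gridQuad_const_mul, gridQuad_add]
  have h1 := gridQuad_level_sq_le (n := n) (L := n + 1) le_rfl A
  have h2 := gridQuad_level_sq_le (n := n) (L := n) (by omega) B
  nlinarith [sq_nonneg ((n : ℝ) + 2)]

/-- Parseval in `y'` reduces this to the univariate kernel. The factor `1 - s x'` saves one power of
`n` over the order `n⁶` possible at a corner. -/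
theorem gridQuad_one_sub_mul_kernel₂_sq_le (n : ℕ) :
    gridQuad n (fun x' y' => (1 - s * x') * kernel₂ n x y x' y' ^ 2) ≤ 12 * (n + 2) ^ 5 := by
  have e : gridQuad n (fun x' y' => (1 - s * x') * kernel₂ n x y x' y' ^ 2) =
      ∑ j ∈ range (n + 1), chebU j y ^ 2 *
        sineQuad (n + 2) (fun x' => (1 - s * x') * kernel₁ (n - j) x x' ^ 2) := by
    simp only [gridQuad, sineQuad_const_mul, kernel₂,
      sineQuad_sum_sq (show n + 1 < n + 3 by omega), mul_sum, sineQuad_sum]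
    refine sum_congr rfl fun j _ => ?_
    rw [← sineQuad_const_mul]
    congr 1
    funext t
    ring
  have hN : (1 : ℝ) ≤ n + 2 := by linarith [n.cast_nonneg (α := ℝ)]
  have hker : ∀ j ∈ range (n + 1), sineQuad (n + 2)
      (fun x' => (1 - s * x') * kernel₁ (n - j) x x' ^ 2) ≤ 3 * (n + 2) ^ 2 := by
    intro j hj
    rw [mem_range] at hj
    rw [sineQuad_one_sub_mul_kernel₁_sq (by omega)]
    have h1 : (1 - s * x) * ∑ i ∈ range (n - j + 1), chebU i x ^ 2 ≤ n + 2 := by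
      rw [mul_sum]
      refine (sum_le_card_nsmul _ _ 1 fun i _ => ?_).trans ?_
      -- Since `s x ≥ 0`, `1 - s x ≤ (1 - s x) (1 + s x) = 1 - x ^ 2`.
      · have h := one_sub_sq_mul_chebU_sq_le_one i x
        have hx2 : x ^ 2 = (s * x) ^ 2 := by rw [mul_pow, hs, one_mul]
        rw [hx2] at h
        refine le_trans ?_ h
        gcongr
        nlinarith
      · rw [card_range, nsmul_one]
        norm_cast
        omega
    have h2 : |s / 2 * (chebU (n - j : ℕ) x * chebU ((n - j : ℕ) + 1) x)| ≤ 2 * (n + 2) ^ 2 := by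
      have hs1 : |s| = 1 := by rw [← sq_abs] at hs; nlinarith [abs_nonneg s]
      have hU := abs_chebU_le_of_le (n := n) (i := (n - j : ℕ)) (by omega) (by omega) hs hsx hx
      have hV := abs_chebU_le_of_le (n := n) (i := (n - j : ℕ) + 1) (by omega) (by omega) hs hsx hx
      rw [abs_mul, abs_mul, abs_div, hs1, abs_two]
      have := mul_le_mul hU hV (abs_nonneg _) (by positivity)
      linarith
    have h3 := le_of_abs_le h2
    nlinarith
  rw [e]
  calc _ ≤ ∑ _j ∈ range (n + 1), 4 * ((n : ℝ) + 2) ^ 2 * (3 * (n + 2) ^ 2) := by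
        refine sum_le_sum fun j hj => ?_
        refine (mul_le_mul_of_nonneg_left (hker j hj) (sq_nonneg _)).trans ?_
        rw [mem_range] at hj
        exact mul_le_mul_of_nonneg_right
          (sq_chebU_le_of_le (by omega) (by omega) hr hry hy) (by positivity)
    _ = (n + 1) * (12 * ((n : ℝ) + 2) ^ 4) := by
        rw [sum_const, card_range, nsmul_eq_mul]
        push_cast
        ring
    _ ≤ (n + 2) * (12 * (n + 2) ^ 4) := by gcongr; norm_num
    _ = 12 * (n + 2) ^ 5 := by ring

end Bounds

theorem gridQuad_kernel₂_sq_le {n : ℕ} {x y b : ℝ} (hx : ∀ i : ℕ, chebU i x ^ 2 ≤ b)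
    (hy : ∀ i : ℕ, chebU i y ^ 2 ≤ b) :
    gridQuad n (fun x' y' => kernel₂ n x y x' y' ^ 2) ≤ ((n + 2) * b) ^ 2 := by
  have hb : 0 ≤ b := (sq_nonneg _).trans (hx 0)
  simp only [gridQuad, kernel₂, sineQuad_sum_sq (show n + 1 < n + 3 by omega), sineQuad_sum, mul_pow,
    sineQuad_const_mul]
  have hker : ∀ j ∈ range (n + 1), chebU j y ^ 2 * sineQuad (n + 2)
      (fun x' => kernel₁ (n - j) x x' ^ 2) ≤ b * ((n + 2) * b) := by
    intro j hj
    simp only [kernel₁]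
    rw [sineQuad_sum_sq (by omega)]
    refine mul_le_mul (hy j) ?_ (sum_nonneg fun _ _ => sq_nonneg _) hb
    refine (sum_le_card_nsmul _ _ b fun i _ => hx i).trans ?_
    rw [card_range, nsmul_eq_mul]
    gcongr
    norm_cast
    omega
  refine (sum_le_card_nsmul _ _ _ hker).trans ?_
  rw [card_range, nsmul_eq_mul]
  push_cast
  nlinarith [mul_nonneg hb hb, n.cast_nonneg (α := ℝ), mul_nonneg (mul_nonneg hb hb) (n.cast_nonneg (α := ℝ))]

theorem gridQuad_one (n : ℕ) : gridQuad n (fun _ _ => 1) = 1 := by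
  have h (N : ℕ) (hN : 2 ≤ N) : sineQuad N (fun _ => 1) = 1 := by
    simpa [chebU_zero] using sineQuad_chebU_mul_chebU (N := N) (i := 0) (j := 0) (by omega)
  simp only [gridQuad]
  rw [h (n + 3) (by omega), h (n + 2) (by omega)]

/-! ### Lorentzian sums over Chebyshev nodes -/

/-- An increasing odd function with values in `(-1, 1)`, and with derivative comparable to
`γ / (s ^ 2 + γ ^ 2)`. -/
noncomputable def sigmoid (γ s : ℝ) : ℝ := s / (|s| + γ)

theorem sigmoid_neg (γ s : ℝ) : sigmoid γ (-s) = -sigmoid γ s := by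
  simp [sigmoid, neg_div]

theorem sigmoid_le_one {γ : ℝ} (hγ : 0 < γ) (s : ℝ) : sigmoid γ s ≤ 1 := by
  rw [sigmoid, div_le_one (by positivity)]
  linarith [le_abs_self s]

theorem neg_one_le_sigmoid {γ : ℝ} (hγ : 0 < γ) (s : ℝ) : -1 ≤ sigmoid γ s := by
  have := sigmoid_le_one hγ (-s)
  rw [sigmoid_neg] at this
  linarith

theorem sigmoid_mono {γ : ℝ} (hγ : 0 < γ) : Monotone (sigmoid γ) := by
  intro s t hst
  rw [sigmoid, sigmoid, div_le_div_iff₀ (by positivity) (by positivity)]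
  rcases abs_cases s with ⟨h1, h2⟩ | ⟨h1, h2⟩ <;> rcases abs_cases t with ⟨h3, h4⟩ | ⟨h3, h4⟩ <;>
    rw [h1, h3] <;> nlinarith [mul_nonneg (sub_nonneg.2 hst) hγ.le]

/-- The Lorentzian is comparable to the derivative of `sigmoid γ` divided by `γ`. By oddness `a ≥
0`. If `d ≤ a`, the increment over `[a - d, a]` is explicit; otherwise this interval contains the
peak and the increment is at least `d / (d + γ)`, where `d N ≤ 1` is used. -/
theorem mul_div_le_sigmoid_sub {γ a d N : ℝ} (hγ : 0 < γ) (hd : 0 ≤ d) (hN : 0 ≤ N)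
    (hdN : d * N ≤ 1) :
    d * N / (a ^ 2 + γ ^ 2) ≤
      2 * (N / γ + 1 / γ ^ 2) * (sigmoid γ (a + d) - sigmoid γ (a - d)) := by
  wlog ha : 0 ≤ a generalizing a
  · have h := this (a := -a) (by linarith)
    rw [show -a + d = -(a - d) by ring, show -a - d = -(a + d) by ring, sigmoid_neg,
      sigmoid_neg, neg_sq] at h
    linarith
  have hmono : sigmoid γ a - sigmoid γ (a - d) ≤ sigmoid γ (a + d) - sigmoid γ (a - d) := by
    linarith [sigmoid_mono hγ (show a ≤ a + d by linarith)]
  refine le_trans ?_ (mul_le_mul_of_nonneg_left hmono (by positivity))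
  rcases le_total d a with hda | hda
  · have hb : 0 ≤ a - d := by linarith
    have e : sigmoid γ a - sigmoid γ (a - d) = γ * d / ((a + γ) * (a - d + γ)) := by
      rw [sigmoid, sigmoid, abs_of_nonneg ha, abs_of_nonneg hb]
      field_simp
      ring
    rw [e]
    have h1 : d / (a ^ 2 + γ ^ 2) ≤ 2 * d / ((a + γ) * (a - d + γ)) := by
      rw [div_le_div_iff₀ (by positivity) (by positivity)]
      have h2 : (a + γ) * (a - d + γ) ≤ 2 * (a ^ 2 + γ ^ 2) := by
        nlinarith [sq_nonneg (a - γ)]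
      nlinarith
    calc d * N / (a ^ 2 + γ ^ 2) = d / (a ^ 2 + γ ^ 2) * N := by ring
      _ ≤ 2 * d / ((a + γ) * (a - d + γ)) * N := by gcongr
      _ = 2 * (N / γ) * (γ * d / ((a + γ) * (a - d + γ))) := by field_simp
      _ ≤ 2 * (N / γ + 1 / γ ^ 2) * (γ * d / ((a + γ) * (a - d + γ))) := by
        gcongr
        linarith [show 0 ≤ 1 / γ ^ 2 by positivity]
  · have hb : 0 ≤ d - a := by linarith
    have e : d / (d + γ) ≤ sigmoid γ a - sigmoid γ (a - d) := by
      rw [← neg_sub d a, sigmoid_neg, sub_neg_eq_add, sigmoid, sigmoid, abs_of_nonneg ha,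
        abs_of_nonneg hb]
      calc d / (d + γ) = a / (d + γ) + (d - a) / (d + γ) := by ring
        _ ≤ _ := by gcongr; linarith
    calc d * N / (a ^ 2 + γ ^ 2) ≤ d * N / γ ^ 2 := by gcongr; nlinarith [sq_nonneg a]
      _ = (d * N / γ ^ 2 + N / γ) * (d / (d + γ)) := by field_simp
      _ ≤ (1 / γ ^ 2 + N / γ) * (d / (d + γ)) := by gcongr
      _ ≤ (2 * (N / γ + 1 / γ ^ 2)) * (sigmoid γ a - sigmoid γ (a - d)) := by
        refine mul_le_mul ?_ e (by positivity) (by positivity)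
        linarith [show 0 ≤ N / γ + 1 / γ ^ 2 by positivity]

theorem sin_mul_div_pi_le_cos_sub_cos {α η : ℝ} (hα : 0 ≤ α) (hη : 0 ≤ η) (h : α + η ≤ π) :
    sin α * (η / π) ≤ cos α - cos (α + η) := by
  have e : cos α - cos (α + η) = 2 * sin (α + η / 2) * sin (η / 2) := by
    rw [cos_sub_cos, show (α + (α + η)) / 2 = α + η / 2 by ring,
      show (α - (α + η)) / 2 = -(η / 2) by ring, sin_neg]
    ring
  have hs0 : 0 ≤ sin α := sin_nonneg_of_nonneg_of_le_pi hα (by linarith)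
  have hs1 : 0 ≤ sin (α + η) := sin_nonneg_of_nonneg_of_le_pi (by linarith) h
  have hs2 : 0 ≤ sin (α + η / 2) := sin_nonneg_of_nonneg_of_le_pi (by linarith) (by linarith)
  have h2 : 2 * sin (α + η / 2) * cos (η / 2) = sin α + sin (α + η) := by
    rw [sin_add_sin, show (α + (α + η)) / 2 = α + η / 2 by ring,
      show (α - (α + η)) / 2 = -(η / 2) by ring, cos_neg]
  have h3 : sin α ≤ 2 * sin (α + η / 2) := by nlinarith [cos_le_one (η / 2)]
  have h4 : η / π ≤ sin (η / 2) := by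
    have := mul_le_sin (x := η / 2) (by linarith) (by linarith)
    refine le_trans (le_of_eq ?_) this
    ring
  rw [e]
  exact mul_le_mul h3 h4 (by positivity) (by positivity)

/-- Neighbouring nodes are at least `sin θ / N` away from `cos θ`, so each term is controlled by the
increment of the sigmoid between the two neighbours. These increments telescope to four values in
`[-1, 1]`. -/
theorem sum_sin_div_le {N : ℕ} (hN : N ≠ 0) (t : ℝ) {γ : ℝ} (hγ : 0 < γ) :
    ∑ j ∈ range N, sin (j * π / N) / ((cos (j * π / N) - t) ^ 2 + γ ^ 2) ≤
      8 * (N / γ + 1 / γ ^ 2) := by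
  obtain ⟨M, rfl⟩ := Nat.exists_eq_succ_of_ne_zero hN
  set N : ℝ := ((M + 1 : ℕ) : ℝ) with hNdef
  have hNpos : 0 < N := by positivity
  set G : ℕ → ℝ := fun j => sigmoid γ (cos (j * π / N) - t) with hG
  have htel : ∀ L : ℕ, ∑ i ∈ range L, (G i - G (i + 2)) = G 0 + G 1 - G L - G (L + 1) := by
    intro L
    induction L with
    | zero => simp
    | succ L ih =>
      rw [sum_range_succ, ih]
      ring
  have hterm : ∀ i ∈ range M, sin (((i + 1 : ℕ) : ℝ) * π / N) /
      ((cos (((i + 1 : ℕ) : ℝ) * π / N) - t) ^ 2 + γ ^ 2) ≤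
        2 * (N / γ + 1 / γ ^ 2) * (G i - G (i + 2)) := by
    intro i hi
    rw [mem_range] at hi
    set θ : ℝ := ((i + 1 : ℕ) : ℝ) * π / N with hθ
    have hη : 0 ≤ π / N := by positivity
    have hlow : π / N ≤ θ := by
      rw [hθ]
      push_cast
      gcongr
      nlinarith [pi_pos, mul_nonneg (i.cast_nonneg (α := ℝ)) pi_pos.le]
    have hup : θ + π / N ≤ π := by
      have : ((i + 1 : ℕ) : ℝ) + 1 ≤ N := by rw [hNdef]; exact_mod_cast Nat.succ_le_succ hi
      rw [hθ, ← add_div, div_le_iff₀ hNpos]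
      nlinarith [pi_pos]
    have hs0 : 0 ≤ sin θ := sin_nonneg_of_nonneg_of_le_pi (by linarith) (by linarith)
    have e1 : π / N / π = 1 / N := by field_simp
    have hgap1 := sin_mul_div_pi_le_cos_sub_cos (hη.trans hlow) hη hup
    have hgap2 := sin_mul_div_pi_le_cos_sub_cos (α := π - θ) (η := π / N)
      (by linarith) hη (by linarith)
    rw [show π - θ + π / N = π - (θ - π / N) by ring, cos_pi_sub, cos_pi_sub, sin_pi_sub] at hgap2
    rw [e1, mul_one_div] at hgap1 hgap2
    have hGi : sigmoid γ (cos θ - t + sin θ / N) ≤ G i := by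
      refine sigmoid_mono hγ ?_
      rw [show (i : ℝ) * π / N = θ - π / N by rw [hθ]; push_cast; ring]
      linarith
    have hGi2 : G (i + 2) ≤ sigmoid γ (cos θ - t - sin θ / N) := by
      refine sigmoid_mono hγ ?_
      rw [show ((i + 2 : ℕ) : ℝ) * π / N = θ + π / N by rw [hθ]; push_cast; ring]
      linarith
    have hd : sin θ / N * N = sin θ := by field_simp
    have h := mul_div_le_sigmoid_sub (a := cos θ - t) (d := sin θ / N) (N := N) hγ
      (by positivity) hNpos.le (by rw [hd]; exact sin_le_one θ)
    rw [hd] at h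
    refine h.trans ?_
    gcongr
  rw [sum_range_succ']
  simp only [Nat.cast_zero, zero_mul, zero_div, sin_zero, add_zero]
  refine (sum_le_sum hterm).trans ?_
  rw [← mul_sum, htel]
  have hb : G 0 + G 1 - G M - G (M + 1) ≤ 4 := by
    have h1 := sigmoid_le_one hγ (cos ((0 : ℕ) * π / N) - t)
    have h2 := sigmoid_le_one hγ (cos ((1 : ℕ) * π / N) - t)
    have h3 := neg_one_le_sigmoid hγ (cos (M * π / N) - t)
    have h4 := neg_one_le_sigmoid hγ (cos ((M + 1 : ℕ) * π / N) - t)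
    simp only [hG]
    linarith
  have hc : 0 ≤ 2 * (N / γ + 1 / γ ^ 2) := by positivity
  nlinarith [mul_le_mul_of_nonneg_left hb hc]

theorem sineQuad_inv_le {N : ℕ} (hN : N ≠ 0) (t : ℝ) {γ : ℝ} (hγ : 0 < γ) :
    sineQuad N (fun y => ((y - t) ^ 2 + γ ^ 2)⁻¹) ≤ 16 * (1 / γ + 1 / (N * γ ^ 2)) := by
  have h := sum_sin_div_le hN t hγ
  have hN' : (0 : ℝ) < N := by positivity
  calc sineQuad N (fun y => ((y - t) ^ 2 + γ ^ 2)⁻¹)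
      ≤ 2 / N * ∑ j ∈ range N, sin (j * π / N) / ((cos (j * π / N) - t) ^ 2 + γ ^ 2) := by
        unfold sineQuad
        gcongr with j hj
        rw [div_eq_mul_inv (sin _)]
        refine mul_le_mul_of_nonneg_right ?_ (by positivity)
        rw [mem_range] at hj
        have h0 : 0 ≤ sin (j * π / N) := by
          refine sin_nonneg_of_nonneg_of_le_pi (by positivity) ?_
          rw [div_le_iff₀ hN', mul_comm]
          gcongr
        nlinarith [sin_le_one (j * π / N)]
    _ ≤ 2 / N * (8 * (N / γ + 1 / γ ^ 2)) := by gcongr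
    _ = 16 * (1 / γ + 1 / (N * γ ^ 2)) := by field_simp; ring

theorem abs_cos_lt_one {m N : ℕ} (h0 : m ≠ 0) (h : m < N) : |cos (m * π / N)| < 1 := by
  have hN : (0 : ℝ) < N := by exact_mod_cast (Nat.zero_le m).trans_lt h
  have hpos : 0 < sin (m * π / N) := by
    refine sin_pos_of_pos_of_lt_pi (by positivity) ?_
    rw [div_lt_iff₀ hN, mul_comm]
    gcongr
  rw [← sq_lt_one_iff_abs_lt_one]
  nlinarith [sin_sq_add_cos_sq (m * π / N)]

/-! ### The `L¹` norm of the kernel -/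

/-- The weight that measures the distance of `(x', y')` to the line through `(x, y)` on which the
kernel is concentrated. -/
noncomputable def concentration (n : ℕ) (s σ x y x' y' : ℝ) : ℝ :=
  ((x' - x) - σ * (y' - y)) ^ 2 + (1 - s * x') / (n + 2) ^ 2

/-- For fixed `x' = c` the reciprocal weight is a Lorentzian in `y'` of width `w / (n + 2)`, `w =
√(1 - s c)`. Its quadrature is `O(n / w + n / w ^ 2)`, and the factor `1 - c ^ 2 ≤ 2 w ^ 2` of the
`x'` quadrature absorbs the singularity. -/
theorem gridQuad_inv_concentration_le (n : ℕ) {s σ : ℝ} (hs : s ^ 2 = 1) (hσ : σ ^ 2 = 1)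
    (x y : ℝ) :
    gridQuad n (fun x' y' => (concentration n s σ x y x' y')⁻¹) ≤ 160 * (n + 2) := by
  have hN : (0 : ℝ) < n + 2 := by positivity
  have hs1 : |s| = 1 := by rw [← sq_abs] at hs; nlinarith [abs_nonneg s]
  have key : ∀ m ∈ range (n + 2), sin (m * π / (n + 2 : ℕ)) ^ 2 *
      sineQuad (n + 3) (fun y' =>
        (concentration n s σ x y (cos (m * π / (n + 2 : ℕ))) y')⁻¹) ≤ 80 * (n + 2) := by
    intro m hm
    rw [mem_range] at hm
    rcases eq_or_ne m 0 with rfl | hm0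
    · simp only [Nat.cast_zero, zero_mul, zero_div, sin_zero]
      norm_num
      positivity
    have hlt := abs_cos_lt_one hm0 hm
    have hsin := sin_sq_add_cos_sq (m * π / (n + 2 : ℕ))
    set c := cos (m * π / (n + 2 : ℕ))
    have hsc : |s * c| < 1 := by rwa [abs_mul, hs1, one_mul]
    rw [abs_lt] at hsc
    have hh : 0 < 1 - s * c := by linarith
    set w := √(1 - s * c) with hw
    have hwpos : 0 < w := sqrt_pos.2 hh
    have hw2 : w ^ 2 = 1 - s * c := sq_sqrt hh.le
    have hq := sineQuad_inv_le (N := n + 3) (by omega) (y + σ * (c - x))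
      (γ := w / (n + 2)) (by positivity)
    have e : (fun y' => (concentration n s σ x y c y')⁻¹) =
        fun y' => ((y' - (y + σ * (c - x))) ^ 2 + (w / (n + 2)) ^ 2)⁻¹ := by
      funext y'
      rw [concentration, div_pow, hw2]
      congr 2
      linear_combination ((y' - y) ^ 2 - (c - x) ^ 2) * hσ
    have hsin' : sin (m * π / (n + 2 : ℕ)) ^ 2 ≤ 2 * w ^ 2 := by
      have : c ^ 2 = (s * c) ^ 2 := by rw [mul_pow, hs, one_mul]
      nlinarith
    have hwle : w ≤ 3 / 2 := by nlinarith
    have hN3 : 1 / (((n + 3 : ℕ) : ℝ) * (w / (n + 2)) ^ 2) ≤ (n + 2) / w ^ 2 := by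
      rw [div_le_div_iff₀ (by positivity) (by positivity)]
      push_cast
      have : ((n : ℝ) + 2) * ((n + 3) * (w / (n + 2)) ^ 2) = (n + 3) / (n + 2) * w ^ 2 := by
        field_simp
      rw [this]
      gcongr
      rw [le_div_iff₀ hN]
      linarith
    rw [e]
    calc _ ≤ 2 * w ^ 2 * (16 * (1 / (w / (n + 2)) + 1 / (((n + 3 : ℕ) : ℝ) * (w / (n + 2)) ^ 2))) :=
          mul_le_mul hsin' hq (by
            unfold sineQuad
            positivity) (by positivity)
      _ ≤ 2 * w ^ 2 * (16 * (1 / (w / (n + 2)) + (n + 2) / w ^ 2)) := by gcongr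
      _ = 32 * (w + 1) * (n + 2) := by field_simp; ring
      _ ≤ 80 * (n + 2) := by nlinarith
  unfold gridQuad
  rw [sineQuad]
  refine (mul_le_mul_of_nonneg_left (sum_le_card_nsmul _ _ _ key) (by positivity)).trans_eq ?_
  rw [card_range, nsmul_eq_mul]
  push_cast
  field_simp
  ring

/-- Weighted Cauchy-Schwarz. Positivity of `g` is needed only for `|x| < 1`, since grid points with
first index `0` have zero quadrature weight. -/
theorem sq_gridQuad_abs_le (n : ℕ) (f g : ℝ → ℝ → ℝ) (hg : ∀ x y, |x| < 1 → 0 < g x y) {A B : ℝ}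
    (hA : gridQuad n (fun x y => g x y * f x y ^ 2) ≤ A)
    (hB : gridQuad n (fun x y => (g x y)⁻¹) ≤ B) :
    gridQuad n (fun x y => |f x y|) ^ 2 ≤ A * B := by
  simp only [gridQuad_eq_sum] at *
  have hg' : ∀ a ∈ range (n + 2) ×ˢ range (n + 3), sin (a.1 * π / (n + 2)) = 0 ∨
      0 < g (cos (a.1 * π / (n + 2))) (cos (a.2 * π / (n + 3))) := by
    intro a ha
    rw [mem_product, mem_range] at ha
    rcases eq_or_ne a.1 0 with h | h
    · left
      simp [h]
    · right
      have := abs_cos_lt_one h ha.1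
      push_cast at this
      exact hg _ _ this
  have hcs : ∀ w F G : ℝ, 0 < G → (w * |F|) ^ 2 ≤ w * (G * F ^ 2) * (w * G⁻¹) := by
    intro w F G hG
    rw [mul_pow, sq_abs]
    refine le_of_eq ?_
    linear_combination (-(w ^ 2 * F ^ 2)) * mul_inv_cancel₀ hG.ne'
  have hf_nonneg : ∀ a ∈ range (n + 2) ×ˢ range (n + 3),
      0 ≤ 4 / (((n : ℝ) + 2) * (n + 3)) * (sin (a.1 * π / (n + 2)) ^ 2 *
        sin (a.2 * π / (n + 3)) ^ 2) * (g (cos (a.1 * π / (n + 2))) (cos (a.2 * π / (n + 3))) *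
          f (cos (a.1 * π / (n + 2))) (cos (a.2 * π / (n + 3))) ^ 2) := by
    intro a ha
    rcases hg' a ha with h | h
    · simp [h]
    · positivity
  have hg_nonneg : ∀ a ∈ range (n + 2) ×ˢ range (n + 3),
      0 ≤ 4 / (((n : ℝ) + 2) * (n + 3)) * (sin (a.1 * π / (n + 2)) ^ 2 *
        sin (a.2 * π / (n + 3)) ^ 2) *
          (g (cos (a.1 * π / (n + 2))) (cos (a.2 * π / (n + 3))))⁻¹ := by
    intro a ha
    rcases hg' a ha with h | h
    · simp [h]
    · positivity
  refine (sum_sq_le_sum_mul_sum_of_sq_le_mul _ hf_nonneg hg_nonneg fun a ha => ?_).trans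
    (mul_le_mul hA hB (sum_nonneg hg_nonneg) ((sum_nonneg hf_nonneg).trans hA))
  rcases hg' a ha with h | h
  · simp [h]
  · exact hcs _ _ _ h

theorem gridQuad_abs_kernel₂_le (n : ℕ) {x y : ℝ} (hx : |x| ≤ 1) (hy : |y| ≤ 1) :
    gridQuad n (fun x' y' => |kernel₂ n x y x' y'|) ≤ 84 * (n + 2) ^ 2 := by
  have hsign : ∀ t : ℝ, |t| ≤ 1 → ∃ s : ℝ, s ^ 2 = 1 ∧ 0 ≤ s * t ∧ s * t ≤ 1 := by
    intro t ht
    rcases le_total 0 t with h | h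
    · exact ⟨1, by norm_num, by simpa, by simpa [abs_of_nonneg h] using ht⟩
    · exact ⟨-1, by norm_num, by simpa, by simpa [abs_of_nonpos h] using ht⟩
  obtain ⟨s, hs, hsx, hsx1⟩ := hsign x hx
  obtain ⟨r, hr, hry, hry1⟩ := hsign y hy
  have hs1 : |s| = 1 := by rw [← sq_abs] at hs; nlinarith [abs_nonneg s]
  have hN : (0 : ℝ) < n + 2 := by positivity
  have hpos : ∀ x' y', |x'| < 1 → 0 < concentration n s (s * r) x y x' y' := by
    intro x' y' hx'
    have : |s * x'| < 1 := by rwa [abs_mul, hs1, one_mul]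
    rw [abs_lt] at this
    have h1 : 0 < (1 - s * x') / ((n : ℝ) + 2) ^ 2 := div_pos (by linarith) (by positivity)
    rw [concentration]
    positivity
  have h1 := gridQuad_inv_concentration_le n hs (σ := s * r) (by rw [mul_pow, hs, hr, one_mul]) x y
  have h2 : gridQuad n (fun x' y' => concentration n s (s * r) x y x' y' *
      kernel₂ n x y x' y' ^ 2) ≤ 44 * (n + 2) ^ 3 := by
    have e : (fun x' y' => concentration n s (s * r) x y x' y' * kernel₂ n x y x' y' ^ 2) =
        fun x' y' => ((x' - x) - s * r * (y' - y)) ^ 2 * kernel₂ n x y x' y' ^ 2 +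
          1 / ((n : ℝ) + 2) ^ 2 * ((1 - s * x') * kernel₂ n x y x' y' ^ 2) := by
      funext x' y'
      rw [concentration]
      ring
    rw [e, gridQuad_add, gridQuad_const_mul]
    have h3 := gridQuad_sub_sq_mul_kernel₂_sq_le hs hsx hsx1 hr hry hry1 n
    have h4 := gridQuad_one_sub_mul_kernel₂_sq_le hs hsx hsx1 hr hry hry1 n
    have h5 := mul_le_mul_of_nonneg_left h4 (show 0 ≤ 1 / ((n : ℝ) + 2) ^ 2 by positivity)
    have e2 : 1 / ((n : ℝ) + 2) ^ 2 * (12 * (n + 2) ^ 5) = 12 * (n + 2) ^ 3 := by field_simp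
    linarith
  refine (abs_le_of_sq_le_sq' ?_ (by positivity)).2
  refine (sq_gridQuad_abs_le n (kernel₂ n x y) _ hpos h2 h1).trans ?_
  -- `44 * 160 = 7040 ≤ 84 ^ 2`.
  nlinarith [pow_pos hN 4]

/-! ### Morrow-Patterson nodes and cubature -/

/-- The index set of the Morrow-Patterson points inside the product grid. -/
def nodeIndex (n : ℕ) : Finset (ℕ × ℕ) :=
  {a ∈ range (n + 2) ×ˢ range (n + 3) | a.1 ≠ 0 ∧ a.2 ≠ 0 ∧ Odd (a.1 + a.2)}

/-- The point of the product grid with index `a`. -/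
noncomputable def gridNode (n : ℕ) (a : ℕ × ℕ) : ℝ × ℝ :=
  (cos (a.1 * π / (n + 2)), cos (a.2 * π / (n + 3)))

/-- The weight of the Morrow-Patterson cubature formula. -/
noncomputable def weight (n : ℕ) (a : ℕ × ℕ) : ℝ :=
  2 * (4 / ((n + 2) * (n + 3)) * (sin (a.1 * π / (n + 2)) ^ 2 * sin (a.2 * π / (n + 3)) ^ 2))

/-- The pairs `⟨j, i⟩` with `i + j ≤ n`. -/
def triangle (n : ℕ) : Finset (Σ _ : ℕ, ℕ) := (range (n + 1)).sigma fun j => range (n - j + 1)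

theorem mem_triangle {n : ℕ} {t : Σ _ : ℕ, ℕ} : t ∈ triangle n ↔ t.2 + t.1 ≤ n := by
  simp only [triangle, mem_sigma, mem_range]
  omega

/-- The value at `z` of the product Chebyshev polynomial `U_i(x) U_j(y)`, where `t = ⟨j, i⟩`. -/
noncomputable def chebProd (t : Σ _ : ℕ, ℕ) (z : ℝ × ℝ) : ℝ := chebU t.2 z.1 * chebU t.1 z.2

theorem kernel₂_eq_sum (n : ℕ) (z w : ℝ × ℝ) :
    kernel₂ n z.1 z.2 w.1 w.2 = ∑ t ∈ triangle n, chebProd t z * chebProd t w := by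
  simp only [kernel₂, kernel₁, triangle, sum_sigma, chebProd, mul_sum, sum_mul]
  exact sum_congr rfl fun _ _ => sum_congr rfl fun _ _ => by ring

/-- The index in the product grid of the node `(x_m, y_k)`. -/
def nodeIndexOf (p : ℕ × ℕ) : ℕ × ℕ := (p.1, if Odd p.1 then 2 * p.2 else 2 * p.2 - 1)

theorem nodeIndex_eq_image {n : ℕ} (hn : Even n) :
    nodeIndex n = (Icc 1 (n + 1) ×ˢ Icc 1 (n / 2 + 1)).image nodeIndexOf := by
  obtain ⟨r, rfl⟩ := hn
  ext ⟨m, j⟩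
  simp only [nodeIndex, nodeIndexOf, mem_filter, mem_product, mem_range, mem_image, mem_Icc,
    Prod.exists, Prod.mk.injEq]
  constructor
  · rintro ⟨⟨h1, h2⟩, h3, h4, h5⟩
    refine ⟨m, (j + 1) / 2, by omega, rfl, ?_⟩
    rw [Nat.odd_iff] at h5
    split_ifs with h <;> rw [Nat.odd_iff] at h <;> omega
  · rintro ⟨m, k, h1, rfl, h2⟩
    split_ifs at h2 with h <;> rw [Nat.odd_iff] at h ⊢ <;> omega

theorem card_nodeIndex {n : ℕ} (hn : Even n) : #(nodeIndex n) = (n + 1) * (n / 2 + 1) := by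
  rw [nodeIndex_eq_image hn, card_image_of_injOn]
  · simp
  · rintro ⟨m, k⟩ h ⟨m', k'⟩ h' e
    simp only [nodeIndexOf, Prod.mk.injEq, coe_product, Set.mem_prod, mem_coe, mem_Icc] at e h h'
    obtain ⟨rfl, e⟩ := e
    rw [Prod.mk.injEq]
    split_ifs at e <;> omega

theorem card_triangle {n : ℕ} (hn : Even n) : #(triangle n) = (n + 1) * (n / 2 + 1) := by
  obtain ⟨r, rfl⟩ := hn
  rw [triangle, card_sigma]
  simp only [card_range]
  rw [sum_flip (fun j => j + 1)]
  have h := sum_range_id_mul_two (r + r + 1 + 1)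
  rw [sum_range_succ'] at h
  have e : (r + r) / 2 = r := by omega
  rw [e]
  simp only [add_zero, Nat.add_sub_cancel] at h
  nlinarith

theorem points_eq_image {n : ℕ} (hn : Even n) : points n = (nodeIndex n).image (gridNode n) := by
  classical
  rw [nodeIndex_eq_image hn, image_image, points]
  refine image_congr fun p hp => ?_
  simp only [coe_product, Set.mem_prod, mem_coe, mem_Icc] at hp
  simp only [node, gridNode, nodeIndexOf, Function.comp]
  split_ifs with h
  · push_cast
    rfl
  · rw [Nat.cast_sub (by omega)]
    push_cast
    rfl

theorem injOn_gridNode (n : ℕ) : Set.InjOn (gridNode n) (nodeIndex n) := by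
  rintro ⟨m, j⟩ h ⟨m', j'⟩ h' e
  simp only [nodeIndex, coe_filter, mem_product, mem_range, Set.mem_ofPred_eq] at h h'
  simp only [gridNode, Prod.mk.injEq] at e
  have key : ∀ {a b N : ℕ} (x : ℝ), x = N → a < N → b < N → cos (a * π / x) = cos (b * π / x) →
      a = b := by
    rintro a b N _ rfl ha hb hab
    have hN : (0 : ℝ) < N := by exact_mod_cast (Nat.zero_le a).trans_lt ha
    have hmem : ∀ c : ℕ, c < N → c * π / N ∈ Set.Icc 0 π := by
      intro c hc
      refine ⟨by positivity, ?_⟩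
      rw [div_le_iff₀ hN, mul_comm]
      gcongr
    have := injOn_cos (hmem a ha) (hmem b hb) hab
    field_simp at this
    exact_mod_cast this
  rw [Prod.mk.injEq]
  exact ⟨key (N := n + 2) _ (by push_cast; rfl) h.1.1 h'.1.1 e.1,
    key (N := n + 3) _ (by push_cast; rfl) h.1.2 h'.1.2 e.2⟩

theorem sum_points {n : ℕ} (hn : Even n) (f : ℝ × ℝ → ℝ) :
    ∑ a ∈ points n, f a = ∑ a ∈ nodeIndex n, f (gridNode n a) := by
  rw [points_eq_image hn, sum_image (injOn_gridNode n)]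

/-- The factor `1 - (-1) ^ (m + j)` is `2` on odd sums and `0` on even ones; points with a zero
index have zero weight. -/
theorem sum_weight_mul (n : ℕ) (f : ℕ × ℕ → ℝ) :
    ∑ a ∈ nodeIndex n, weight n a * f a =
      ∑ a ∈ range (n + 2) ×ˢ range (n + 3),
        (1 - (-1) ^ a.1 * (-1) ^ a.2) * (weight n a / 2 * f a) := by
  rw [nodeIndex, sum_filter]
  refine sum_congr rfl fun a _ => ?_
  split_ifs with h
  · rw [← pow_add, h.2.2.neg_one_pow]
    ring
  · by_cases h0 : a.1 ≠ 0 ∧ a.2 ≠ 0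
    · have he : Even (a.1 + a.2) := by
        rw [← Nat.not_odd_iff_even]
        tauto
      rw [← pow_add, he.neg_one_pow]
      ring
    · have hw : weight n a = 0 := by
        rw [not_and_or, not_not, not_not] at h0
        rcases h0 with h0 | h0 <;> simp [weight, h0]
      rw [hw]
      ring

/-- At `θ = m π / N`, `sin ((N - 1 - i) θ) = -(-1) ^ m sin ((i + 1) θ)`: the alternating sign
reflects the degree `i` to `N - 2 - i`. -/
theorem sum_neg_one_pow_mul_chebU {N i j : ℕ} (hi : i + 2 ≤ N) :
    2 / N * ∑ m ∈ range N, sin (m * π / N) ^ 2 *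
      ((-1) ^ m * (chebU i (cos (m * π / N)) * chebU j (cos (m * π / N)))) =
      -sineQuad N (fun t => chebU (N - 2 - i : ℕ) t * chebU j t) := by
  have hN : (N : ℝ) ≠ 0 := by norm_cast; omega
  rw [sineQuad, ← mul_neg, ← sum_neg_distrib]
  congr 1
  refine sum_congr rfl fun m _ => ?_
  set θ := m * π / N with hθ
  have h : (-1) ^ m * (chebU i (cos θ) * sin θ) = -(chebU (N - 2 - i : ℕ) (cos θ) * sin θ) := by
    rw [chebU_cos, chebU_cos]
    have e : (((N - 2 - i : ℕ) : ℤ) + 1 : ℝ) * θ = m * π - ((i : ℤ) + 1) * θ := by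
      rw [Nat.sub_sub, Nat.cast_sub (by omega), hθ]
      push_cast
      field_simp
      ring
    rw [e, sin_nat_mul_pi_sub]
    ring
  linear_combination (sin θ * chebU j (cos θ)) * h

/-- Exactness of the Morrow-Patterson cubature formula on products of polynomials of degree `n`. -/
theorem sum_weight_mul_chebProd_mul_chebProd {n : ℕ} {t u : Σ _ : ℕ, ℕ} (ht : t ∈ triangle n)
    (hu : u ∈ triangle n) :
    ∑ a ∈ nodeIndex n, weight n a * (chebProd t (gridNode n a) * chebProd u (gridNode n a)) =
      if t = u then 1 else 0 := by
  obtain ⟨j, i⟩ := t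
  obtain ⟨j', i'⟩ := u
  rw [mem_triangle] at ht hu
  simp only at ht hu
  have hprod (F G : ℕ → ℝ) :
      (2 / ((n + 2 : ℕ) : ℝ) * ∑ m ∈ range (n + 2), F m) *
        (2 / ((n + 3 : ℕ) : ℝ) * ∑ m ∈ range (n + 3), G m) =
      ∑ a ∈ range (n + 2) ×ˢ range (n + 3),
        2 / ((n + 2 : ℕ) : ℝ) * (2 / ((n + 3 : ℕ) : ℝ)) * (F a.1 * G a.2) := by
    rw [mul_mul_mul_comm, sum_mul_sum, ← sum_product', mul_sum]
  have e : ∑ a ∈ nodeIndex n,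
      weight n a * (chebProd ⟨j, i⟩ (gridNode n a) * chebProd ⟨j', i'⟩ (gridNode n a)) =
      sineQuad (n + 2) (fun t => chebU i t * chebU i' t) *
        sineQuad (n + 3) (fun t => chebU j t * chebU j' t) -
      sineQuad (n + 2) (fun t => chebU (n + 2 - 2 - i : ℕ) t * chebU i' t) *
        sineQuad (n + 3) (fun t => chebU (n + 3 - 2 - j : ℕ) t * chebU j' t) := by
    rw [sum_weight_mul, ← neg_mul_neg (sineQuad (n + 2) fun t => chebU (n + 2 - 2 - i : ℕ) t * _),
      ← sum_neg_one_pow_mul_chebU (by omega), ← sum_neg_one_pow_mul_chebU (by omega)]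
    simp only [sineQuad]
    rw [hprod, hprod, ← sum_sub_distrib]
    refine sum_congr rfl fun a _ => ?_
    simp only [weight, chebProd, gridNode]
    push_cast
    field_simp
    ring
  rw [e, sineQuad_chebU_mul_chebU (by omega), sineQuad_chebU_mul_chebU (by omega),
    sineQuad_chebU_mul_chebU (by omega), sineQuad_chebU_mul_chebU (by omega)]
  -- Both equalities would give total degree `i + i' + j + j' = 2 n + 1`, but it is at most `2 n`.
  have h : ¬(n + 2 - 2 - i = i' ∧ n + 3 - 2 - j = j') := by omega
  have h' : (⟨j, i⟩ : Σ _ : ℕ, ℕ) = ⟨j', i'⟩ ↔ i = i' ∧ j = j' := by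
    rw [Sigma.mk.injEq, heq_eq_eq, and_comm]
  simp only [h']
  clear h' e hprod
  split_ifs <;> first | (exfalso; omega) | norm_num

/-- Orthonormality says `A * B = 1`; equal cardinalities make this a two-sided inverse, and `B * A =
1` is the Lagrange property of the weighted kernel. -/
theorem weight_mul_kernel₂ {n : ℕ} (hn : Even n) {a b : ℕ × ℕ} (ha : a ∈ nodeIndex n)
    (hb : b ∈ nodeIndex n) :
    weight n b * ∑ t ∈ triangle n, chebProd t (gridNode n a) * chebProd t (gridNode n b) =
      if a = b then 1 else 0 := by
  classical
  let A : Matrix (triangle n) (nodeIndex n) ℝ := fun t a =>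
    weight n a * chebProd t.1 (gridNode n a)
  let B : Matrix (nodeIndex n) (triangle n) ℝ := fun a t => chebProd t.1 (gridNode n a)
  have hAB : A * B = 1 := by
    ext t u
    rw [Matrix.mul_apply, Matrix.one_apply]
    simp only [A, B]
    rw [sum_coe_sort (nodeIndex n) (fun a => weight n a * chebProd t.1 (gridNode n a) *
      chebProd u.1 (gridNode n a))]
    simp only [mul_assoc]
    rw [sum_weight_mul_chebProd_mul_chebProd t.2 u.2]
    simp only [Subtype.ext_iff]
  have hBA : B * A = 1 := (Matrix.mul_eq_one_comm_of_card_eq _ _ _ (by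
    rw [Fintype.card_coe, Fintype.card_coe, card_triangle hn, card_nodeIndex hn])).1 hAB
  have h := congrFun (congrFun hBA ⟨a, ha⟩) ⟨b, hb⟩
  rw [Matrix.mul_apply, Matrix.one_apply] at h
  simp only [A, B, Subtype.mk.injEq] at h
  rw [sum_coe_sort (triangle n) (fun t => chebProd t (gridNode n a) *
    (weight n b * chebProd t (gridNode n b)))] at h
  rw [← h, mul_sum]
  exact sum_congr rfl fun _ _ => by ring

/-! ### Chebyshev products span the polynomial space; unisolvence -/

/-- The polynomial `U_i(X) U_j(Y)`. -/
noncomputable def chebPoly (i j : ℤ) : MvPolynomial (Fin 2) ℝ :=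
  Polynomial.aeval (MvPolynomial.X 0) (Polynomial.Chebyshev.U ℝ i) *
    Polynomial.aeval (MvPolynomial.X 1) (Polynomial.Chebyshev.U ℝ j)

theorem X_zero_mul_chebPoly (i j : ℤ) :
    MvPolynomial.X 0 * chebPoly i j = (1 / 2 : ℝ) • (chebPoly (i + 1) j + chebPoly (i - 1) j) := by
  have h : chebPoly (i + 1) j + chebPoly (i - 1) j =
      (2 : ℝ) • (MvPolynomial.X 0 * chebPoly i j) := by
    simp only [chebPoly, Polynomial.Chebyshev.U_add_one, map_sub, map_mul, Polynomial.aeval_X,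
      map_ofNat, two_smul]
    ring
  rw [h, smul_smul]
  norm_num

theorem X_one_mul_chebPoly (i j : ℤ) :
    MvPolynomial.X 1 * chebPoly i j = (1 / 2 : ℝ) • (chebPoly i (j + 1) + chebPoly i (j - 1)) := by
  have h : chebPoly i (j + 1) + chebPoly i (j - 1) =
      (2 : ℝ) • (MvPolynomial.X 1 * chebPoly i j) := by
    simp only [chebPoly, Polynomial.Chebyshev.U_add_one, map_sub, map_mul, Polynomial.aeval_X,
      map_ofNat, two_smul]
    ring
  rw [h, smul_smul]
  norm_num

theorem chebPoly_mem_polySpace {n i j : ℕ} (h : i + j ≤ n) : chebPoly i j ∈ polySpace n := by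
  have key : ∀ (k : Fin 2) (p : Polynomial ℝ),
      (Polynomial.aeval (MvPolynomial.X k : MvPolynomial (Fin 2) ℝ) p).totalDegree ≤
        p.natDegree := by
    intro k p
    rw [Polynomial.aeval_eq_sum_range]
    refine (MvPolynomial.totalDegree_finsetSum _ _).trans (Finset.sup_le fun m hm => ?_)
    refine (MvPolynomial.totalDegree_smul_le _ _).trans ?_
    rw [MvPolynomial.totalDegree_X_pow]
    rw [mem_range] at hm
    omega
  rw [polySpace, MvPolynomial.mem_restrictTotalDegree]
  refine (MvPolynomial.totalDegree_mul _ _).trans ?_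
  have h1 := key 0 (Polynomial.Chebyshev.U ℝ i)
  have h2 := key 1 (Polynomial.Chebyshev.U ℝ j)
  rw [Polynomial.Chebyshev.natDegree_U_natCast] at h1 h2
  omega

theorem evalAt_chebPoly (i j : ℤ) (z : ℝ × ℝ) :
    evalAt (chebPoly i j) z = chebU i z.1 * chebU j z.2 := by
  have key : ∀ (k : Fin 2) (p : Polynomial ℝ), MvPolynomial.eval ![z.1, z.2]
      (Polynomial.aeval (MvPolynomial.X k : MvPolynomial (Fin 2) ℝ) p) =
        p.eval (![z.1, z.2] k) := by
    intro k p
    rw [Polynomial.aeval_def, Polynomial.hom_eval₂, MvPolynomial.eval_X, Polynomial.eval,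
      MvPolynomial.algebraMap_eq]
    congr 1
    ext
    simp
  rw [evalAt, chebPoly, map_mul, key, key]
  rfl

/-- Evaluation at a point, as a linear map. -/
noncomputable def evalLin (z : ℝ × ℝ) : MvPolynomial (Fin 2) ℝ →ₗ[ℝ] ℝ :=
  (MvPolynomial.aeval ![z.1, z.2]).toLinearMap

theorem evalLin_apply (z : ℝ × ℝ) (p : MvPolynomial (Fin 2) ℝ) : evalLin z p = evalAt p z := by
  simp [evalLin, evalAt, MvPolynomial.aeval_eq_eval]

/-- The span of the products `U_i(X) U_j(Y)` with `i + j ≤ n`. -/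
noncomputable def chebSpan (n : ℕ) : Submodule ℝ (MvPolynomial (Fin 2) ℝ) :=
  Submodule.span ℝ ((fun t : Σ _ : ℕ, ℕ => chebPoly t.2 t.1) '' triangle n)

theorem chebPoly_mem_chebSpan {n i j : ℕ} (h : i + j ≤ n) : chebPoly i j ∈ chebSpan n :=
  Submodule.subset_span ⟨⟨j, i⟩, mem_triangle.2 h, rfl⟩

theorem chebPoly_sub_one_mem_chebSpan {n i j : ℕ} (h : i + j ≤ n + 1) :
    chebPoly (i - 1) j ∈ chebSpan n ∧ chebPoly j (i - 1) ∈ chebSpan n := by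
  rcases Nat.eq_zero_or_pos i with rfl | hi
  · simp [chebPoly]
  · obtain ⟨i, rfl⟩ := Nat.exists_eq_succ_of_ne_zero hi.ne'
    rw [Nat.cast_succ, add_sub_cancel_right]
    exact ⟨chebPoly_mem_chebSpan (by omega), chebPoly_mem_chebSpan (by omega)⟩

theorem X_mul_mem_chebSpan {n : ℕ} (k : Fin 2) {p : MvPolynomial (Fin 2) ℝ} (hp : p ∈ chebSpan n) :
    MvPolynomial.X k * p ∈ chebSpan (n + 1) := by
  induction hp using Submodule.span_induction with
  | mem p hp =>
    obtain ⟨⟨j, i⟩, ht, rfl⟩ := hp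
    rw [mem_coe, mem_triangle] at ht
    fin_cases k
    · simp only [Fin.zero_eta, X_zero_mul_chebPoly]
      exact Submodule.smul_mem _ _ (add_mem (chebPoly_mem_chebSpan (i := i + 1) (by simp only at ht; omega))
        (chebPoly_sub_one_mem_chebSpan (by simp only at ht; omega)).1)
    · simp only [Fin.mk_one, X_one_mul_chebPoly]
      exact Submodule.smul_mem _ _ (add_mem (chebPoly_mem_chebSpan (j := j + 1) (by simp only at ht; omega))
        (chebPoly_sub_one_mem_chebSpan (by simp only at ht; omega)).2)
  | zero => simp
  | add p q _ _ hp hq =>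
    rw [mul_add]
    exact add_mem hp hq
  | smul c p _ hp =>
    rw [mul_smul_comm]
    exact Submodule.smul_mem _ _ hp

theorem chebSpan_mono : Monotone chebSpan := fun m n h =>
  Submodule.span_mono (Set.image_mono fun t ht => by
    rw [mem_coe, mem_triangle] at *
    omega)

/-- Multiplication by a variable averages the two neighbouring Chebyshev degrees, so it raises the
level by at most one; every monomial is reached from `1`. -/
theorem polySpace_le_chebSpan (n : ℕ) : polySpace n ≤ chebSpan n := by
  have hpow : ∀ (k : Fin 2) (a m : ℕ) (p : MvPolynomial (Fin 2) ℝ), p ∈ chebSpan m →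
      MvPolynomial.X k ^ a * p ∈ chebSpan (m + a) := by
    intro k a m p hp
    induction a with
    | zero => simpa
    | succ a ih =>
      rw [pow_succ', mul_assoc]
      exact X_mul_mem_chebSpan k ih
  have hone : (1 : MvPolynomial (Fin 2) ℝ) ∈ chebSpan 0 := by
    have := chebPoly_mem_chebSpan (n := 0) (i := 0) (j := 0) le_rfl
    simpa [chebPoly] using this
  intro p hp
  rw [polySpace, MvPolynomial.mem_restrictTotalDegree] at hp
  rw [p.as_sum]
  refine sum_mem fun v hv => ?_
  have hdeg := (MvPolynomial.le_totalDegree hv).trans hp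
  rw [Finsupp.sum_fintype _ _ (fun _ => rfl), Fin.sum_univ_two] at hdeg
  have h := hpow 0 (v 0) _ _ (hpow 1 (v 1) 0 1 hone)
  rw [MvPolynomial.monomial_eq, Finsupp.prod_fintype _ _ (fun _ => pow_zero _), Fin.prod_univ_two,
    ← MvPolynomial.smul_eq_C_mul]
  refine Submodule.smul_mem _ _ (chebSpan_mono (by omega : v 1 + v 0 ≤ n) ?_)
  simpa using h

/-- The fundamental Lagrange polynomial of the node with index `b`. -/
noncomputable def fundamental (n : ℕ) (b : ℕ × ℕ) : MvPolynomial (Fin 2) ℝ :=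
  weight n b • ∑ t ∈ triangle n, chebProd t (gridNode n b) • chebPoly t.2 t.1

theorem fundamental_mem_polySpace (n : ℕ) (b : ℕ × ℕ) : fundamental n b ∈ polySpace n :=
  Submodule.smul_mem _ _ (sum_mem fun _ ht => Submodule.smul_mem _ _
    (chebPoly_mem_polySpace (mem_triangle.1 ht)))

theorem evalAt_fundamental (n : ℕ) (b : ℕ × ℕ) (z : ℝ × ℝ) :
    evalAt (fundamental n b) z = weight n b *
      ∑ t ∈ triangle n, chebProd t z * chebProd t (gridNode n b) := by
  rw [← evalLin_apply, fundamental, map_smul, map_sum, smul_eq_mul]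
  congr 1
  refine sum_congr rfl fun t _ => ?_
  rw [map_smul, evalLin_apply, evalAt_chebPoly, smul_eq_mul, mul_comm]
  rfl

theorem evalAt_fundamental_gridNode {n : ℕ} (hn : Even n) {a b : ℕ × ℕ} (ha : a ∈ nodeIndex n)
    (hb : b ∈ nodeIndex n) :
    evalAt (fundamental n b) (gridNode n a) = if a = b then 1 else 0 := by
  rw [evalAt_fundamental, weight_mul_kernel₂ hn ha hb]

/-- The cubature formula recovers each Chebyshev coefficient of `p` from its node values. -/
theorem eq_zero_of_evalAt_gridNode_eq_zero {n : ℕ} {p : MvPolynomial (Fin 2) ℝ}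
    (hp : p ∈ polySpace n) (h : ∀ a ∈ nodeIndex n, evalAt p (gridNode n a) = 0) : p = 0 := by
  have hp' := polySpace_le_chebSpan n hp
  rw [chebSpan, Submodule.mem_span_image_finset_iff_exists_fun'] at hp'
  obtain ⟨c, rfl⟩ := hp'
  refine sum_eq_zero fun u hu => ?_
  have hc : c u = ∑ a ∈ nodeIndex n, weight n a * (chebProd u (gridNode n a) *
      ∑ t ∈ triangle n, c t * chebProd t (gridNode n a)) := by
    have e : ∀ a, weight n a * (chebProd u (gridNode n a) *
      ∑ t ∈ triangle n, c t * chebProd t (gridNode n a)) = ∑ t ∈ triangle n, c t *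
        (weight n a * (chebProd u (gridNode n a) * chebProd t (gridNode n a))) := by
      intro a
      rw [mul_sum, mul_sum]
      exact sum_congr rfl fun _ _ => by ring
    simp only [e]
    rw [sum_comm, ← sum_ite_eq_of_mem (triangle n) u c hu]
    refine sum_congr rfl fun t ht => ?_
    rw [← mul_sum, sum_weight_mul_chebProd_mul_chebProd hu ht]
    simp
  rw [hc, sum_eq_zero, zero_smul]
  intro a ha
  have h0 := h a ha
  rw [← evalLin_apply, map_sum] at h0
  simp only [map_smul, evalLin_apply, evalAt_chebPoly, smul_eq_mul] at h0
  rw [show ∑ t ∈ triangle n, c t * chebProd t (gridNode n a) = 0 from h0]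
  simp

theorem isUnisolvent_points {n : ℕ} (hn : Even n) : IsUnisolvent (points n) n := by
  classical
  have hmem : ∀ z, z ∈ points n ↔ ∃ a ∈ nodeIndex n, gridNode n a = z := by
    intro z
    rw [points_eq_image hn, mem_image]
  refine fun f => existsUnique_of_exists_of_unique
    ⟨∑ b ∈ nodeIndex n, f (gridNode n b) • fundamental n b, ?_, fun z hz => ?_⟩ ?_
  · exact sum_mem fun b _ => Submodule.smul_mem _ _ (fundamental_mem_polySpace n b)
  · obtain ⟨a, ha, rfl⟩ := (hmem z).1 hz
    rw [← evalLin_apply, map_sum,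
      ← sum_ite_eq_of_mem (nodeIndex n) a (fun b => f (gridNode n b)) ha]
    refine sum_congr rfl fun b hb => ?_
    rw [map_smul, evalLin_apply, evalAt_fundamental_gridNode hn ha hb]
    simp
  · rintro p q ⟨hp, hpf⟩ ⟨hq, hqf⟩
    refine sub_eq_zero.1 (eq_zero_of_evalAt_gridNode_eq_zero (sub_mem hp hq) fun a ha => ?_)
    have ha' := (hmem _).2 ⟨a, ha, rfl⟩
    rw [← evalLin_apply, map_sub, evalLin_apply, evalLin_apply, hpf _ ha', hqf _ ha', sub_self]

/-! ### Bounds for the Lebesgue function and constant -/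

theorem lagrangePoly_gridNode {n : ℕ} (hn : Even n) {b : ℕ × ℕ} (hb : b ∈ nodeIndex n) :
    lagrangePoly (points n) n (gridNode n b) = fundamental n b := by
  classical
  have huniq := isUnisolvent_points hn (fun z => if z = gridNode n b then 1 else 0)
  have hfund : Interpolates (points n) n (fun z => if z = gridNode n b then 1 else 0)
      (fundamental n b) := by
    refine ⟨fundamental_mem_polySpace n b, fun z hz => ?_⟩
    rw [points_eq_image hn, mem_image] at hz
    obtain ⟨a, ha, rfl⟩ := hz
    rw [evalAt_fundamental_gridNode hn ha hb]
    simp only [(injOn_gridNode n).eq_iff ha hb]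
  refine huniq.unique ?_ hfund
  have h : ∃ p, Interpolates (points n) n (fun z => if z = gridNode n b then 1 else 0) p :=
    ⟨_, hfund⟩
  rw [lagrangePoly, interpolant]
  convert h.choose_spec
  rw [dif_pos]

/-- Node weights are twice the grid weights, and passing to the whole grid only adds nonnegative
terms. -/
theorem lebesgueFunction_points_le {n : ℕ} (hn : Even n) (x y : ℝ) :
    lebesgueFunction (points n) n (x, y) ≤
      2 * gridQuad n (fun x' y' => |kernel₂ n x y x' y'|) := by
  rw [lebesgueFunction, sum_points hn, gridQuad_eq_sum, mul_sum]
  have e : ∀ b ∈ nodeIndex n, |evalAt (lagrangePoly (points n) n (gridNode n b)) (x, y)| =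
      2 * (4 / ((n + 2) * (n + 3)) * (sin (b.1 * π / (n + 2)) ^ 2 * sin (b.2 * π / (n + 3)) ^ 2) *
        |kernel₂ n x y (cos (b.1 * π / (n + 2))) (cos (b.2 * π / (n + 3)))|) := by
    intro b hb
    have hw : 0 ≤ weight n b := by
      unfold weight
      positivity
    rw [lagrangePoly_gridNode hn hb, evalAt_fundamental,
      ← kernel₂_eq_sum n (x, y) (gridNode n b), abs_mul, abs_of_nonneg hw, weight, gridNode]
    ring
  rw [sum_congr rfl e]
  exact sum_le_sum_of_subset_of_nonneg (filter_subset _ _) fun _ _ _ => by positivity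

theorem lebesgueConstant_points_le {n : ℕ} (hn : Even n) (hpos : 0 < n) :
    lebesgueConstant (points n) n ≤ 672 * (n : ℝ) ^ 2 := by
  obtain ⟨⟨x, y⟩, ⟨hx, hy⟩, h⟩ := (isGreatest_lebesgueConstant (points n) n).1
  rw [← h]
  refine (lebesgueFunction_points_le hn x y).trans ?_
  have hk := gridQuad_abs_kernel₂_le n (abs_le.2 hx) (abs_le.2 hy)
  have h2 : (2 : ℝ) ≤ n := by
    obtain ⟨r, rfl⟩ := hn
    norm_cast
    omega
  -- For `n ≥ 2`, `(n + 2) ^ 2 ≤ 4 n ^ 2`, and `672 = 2 * 84 * 4`.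
  nlinarith

theorem lebesgueFunction_points_interior_le {n : ℕ} (hn : Even n) (hpos : 0 < n) {x y c : ℝ}
    (hc : c < 1) (hx : |x| ≤ c) (hy : |y| ≤ c) :
    lebesgueFunction (points n) n (x, y) ≤ 4 / (1 - c ^ 2) * n := by
  have hc0 : 0 ≤ c := (abs_nonneg x).trans hx
  have hc1 : 0 < 1 - c ^ 2 := by nlinarith
  have hU : ∀ t : ℝ, |t| ≤ c → ∀ i : ℕ, chebU i t ^ 2 ≤ 1 / (1 - c ^ 2) := by
    intro t ht i
    have ht2 : t ^ 2 ≤ c ^ 2 := sq_le_sq' (by linarith [neg_abs_le t]) ((le_abs_self t).trans ht)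
    rw [le_div_iff₀ hc1]
    nlinarith [one_sub_sq_mul_chebU_sq_le_one i t, sq_nonneg (chebU i t)]
  -- The constant weight suffices here: the grid quadrature has total mass one and the kernel has
  -- `L²` norm `O(n)`.
  have hcs := sq_gridQuad_abs_le n (kernel₂ n x y) (fun _ _ => 1) (fun _ _ _ => one_pos)
    (A := ((n + 2) * (1 / (1 - c ^ 2))) ^ 2) (B := 1)
    (by simpa only [one_mul] using gridQuad_kernel₂_sq_le (hU x hx) (hU y hy))
    (by simp only [inv_one]; exact (gridQuad_one n).le)
  rw [mul_one] at hcs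
  have hle := (abs_le_of_sq_le_sq' hcs (by positivity)).2
  refine (lebesgueFunction_points_le hn x y).trans ?_
  have h2 : (2 : ℝ) ≤ n := by
    obtain ⟨r, rfl⟩ := hn
    norm_cast
    omega
  calc _ ≤ 2 * ((n + 2) * (1 / (1 - c ^ 2))) := by gcongr
    _ ≤ 2 * ((n + n) * (1 / (1 - c ^ 2))) := by gcongr
    _ = 4 / (1 - c ^ 2) * n := by ring

end MorrowPatterson


theorem mainTheorem1 :
    (∀ n : ℕ, 0 < n → Even n →
      MorrowPatterson.IsUnisolvent (MorrowPatterson.points n) n) ∧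
    (∃ C : ℝ, ∀ n : ℕ, 0 < n → Even n →
      MorrowPatterson.lebesgueConstant (MorrowPatterson.points n) n ≤ C * (n : ℝ) ^ 2) ∧
    (∀ δ : ℝ, 0 < δ → δ < Real.pi / 2 →
      ∃ C : ℝ, ∀ n : ℕ, 0 < n → Even n →
        ∀ x ∈ Set.Icc (Real.cos (Real.pi - δ)) (Real.cos δ),
        ∀ y ∈ Set.Icc (Real.cos (Real.pi - δ)) (Real.cos δ),
          MorrowPatterson.lebesgueFunction (MorrowPatterson.points n) n (x, y) ≤ C * (n : ℝ)) := by
  refine ⟨fun n _ hn => MorrowPatterson.isUnisolvent_points hn,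
    ⟨672, fun n hpos hn => MorrowPatterson.lebesgueConstant_points_le hn hpos⟩,
    fun δ hδ hδ2 => ⟨4 / (1 - Real.cos δ ^ 2), fun n hpos hn x hx y hy => ?_⟩⟩
  have hcos : Real.cos δ < 1 := by
    rw [← Real.cos_zero]
    exact Real.cos_lt_cos_of_nonneg_of_le_pi_div_two le_rfl hδ2.le hδ
  rw [Real.cos_pi_sub] at hx hy
  exact MorrowPatterson.lebesgueFunction_points_interior_le hn hpos hcos
    (abs_le.2 hx) (abs_le.2 hy)
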